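/- **Setting.** Let $p_1,p_2,n,r$ be integers with $r\ge 1$, let $A_1,\dots,A_n\in\mathbb R^{p_1\times p_2}$ and $y\in\mathbb R^n$. Let $\langle X,Z\rangle=\mathrm{tr}(X^\top Z)$ with norm $\|\cdot\|_F$, $\mathcal A(X)=(\langle A_1,X\rangle,\dots,\langle A_n,X\rangle)^\top$ with adjoint $\mathcal A^*$, and $f(X)=\frac12\|y-\mathcal A(X)\|_2^2$. For $k\ge1$ let $R_k$ be the smallest number with $(1-R_k)\|Z\|_F^2\le\|\mathcal A(Z)\|_2^2\le(1+R_k)\|Z\|_F^2$ for all $Z$ of rank at most $k$; $\mathcal A$ satisfies the $k$-RIP if $0\le R_k<1$. Let $\sigma_r(X)$ be the $r$-th largest singular value of $X$. Let $\mathcal M_r=\{X\in\mathbb R^{p_1\times p_2}:\mathrm{rank}(X)=r\}$ carry the metric induced by $\langle\cdot,\cdot\rangle$. For $X\in\mathcal M_r$ let $T_X$ be its tangent space at $X$ (the velocities at $X$ of smooth curves in $\mathcal M_r$), $P_{T_X}$ the orthogonal projector onto $T_X$, and $\mathrm{grad} f(X)\in T_X$ the Riemannian gradient, i.e. the unique $G\in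 T_X$ with $\langle G,Z\rangle=\mathrm Df(X)[Z]$ for all $Z\in T_X$. **RISRO.** The initialization has a singular value decomposition $X^0=U^0\Sigma^0V^{0\top}$ with $U^0\in\mathbb R^{p_1\times r}$, $V^0\in\mathbb R^{p_2\times r}$ having orthonormal columns and $\Sigma^0\in\mathbb R^{r\times r}$. For $t=0,1,\dots$, let $U^t_\perp$, $V^t_\perp$ be orthonormal complements of $U^t$, $V^t$, let $(B^{t+1},D_1^{t+1},D_2^{t+1})$ minimize $$\sum_{i=1}^n\bigl(y_i-\langle B,U^{t\top}A_iV^t\rangle-\langle D_1,U_\perp^{t\top}A_iV^t\rangle-\langle D_2^\top,U^{t\top}A_iV^t_\perp\rangle\bigr)^2$$ over $B\in\mathbb R^{r\times r}$, $D_i\in\mathbb R^{(p_i-r)\times r}$, put $X_U^{t+1}=U^tB^{t+1}+U^t_\perp D_1^{t+1}$, $X_V^{t+1}=V^tB^{t+1\top}+V^t_\perp D_2^{t+1}$, let $U^{t+1},V^{t+1}$ be the $Q$-factors of QR decompositions of $X_U^{t+1},X_V^{t+1}$, and set $X^{t+1}=X_U^{t+1}(B^{t+1})^\dagger X_V^{t+1\top}$,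 with $\dagger$ the Moore–Penrose inverse. The update direction $\eta^t$ is defined by $$X^t+\eta^t=[U^t\ U^t_\perp]\begin{bmatrix}B^{t+1}&D_2^{t+1\top}\\D_1^{t+1}&0\end{bmatrix}[V^t\ V^t_\perp]^\top .$$ **Theorem.** Let $\bar X$ be a rank $r$ matrix that is a stationary point of $f$ subject to $\mathrm{rank}=r$, i.e. $\nabla f(\bar X)^\top\bar U=0$ and $\nabla f(\bar X)\bar V=0$, where $\nabla f(\bar X)=\mathcal A^*(\mathcal A(\bar X)-y)$ and $\bar U,\bar V$ are the left and right singular vectors of $\bar X$. Suppose $\mathcal A$ satisfies the $2r$-RIP, and, with $\bar\epsilon=y-\mathcal A(\bar X)$, $$\|X^0-\bar X\|_F\le\min\Bigl\{\frac14,\frac{1-R_{2r}}{4\sqrt5\,R_{3r}}\Bigr\}\sigma_r(\bar X),\qquad \|\mathcal A^*(\bar\epsilon)\|_F\le\frac{1-R_{2r}}{4\sqrt5}\,\sigma_r(\bar X)$$ (the second term of the minimum is $+\infty$ if $R_{3r}=0$). Then for every $t\ge0$, $X^t\in\mathcal M_r$, and $\eta^t\in T_{X^t}$ solves the Riemannian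 Gauss–Newton (Fisher scoring) equation $$P_{T_{X^t}}\bigl(\mathcal A^*(\mathcal A(\eta^t))\bigr)=-\mathrm{grad} f(X^t).$$ Moreover, for every $t\ge 0$, $B^{t+1}$ is invertible and $X^{t+1}=R(X^t,\eta^t)$, where $R(X^t,\cdot)$ is the orthographic retraction at $X^t$: if $X^t+\eta=[U^t\ U^t_\perp]\begin{bmatrix}B&C\\D&*\end{bmatrix}[V^t\ V^t_\perp]^\top$, then $$R(X^t,\eta)=[U^t\ U^t_\perp]\begin{bmatrix}B&C\\D&DB^{-1}C\end{bmatrix}[V^t\ V^t_\perp]^\top;$$ $X^{t+1}-(X^t+\eta^t)$ is orthogonal to $T_{X^t}$; and $R(X^t,\cdot)$ maps a neighbourhood of $0$ in $T_{X^t}$ smoothly into $\mathcal M_r$, with $R(X^t,0)=X^t$ and $\frac{d}{ds}R(X^t,s\eta)\big|_{s=0}=\eta$ for all $\eta\in T_{X^t}$. -/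

import Mathlib

open Set Filter Topology
open scoped Matrix ContDiff Matrix.Norms.Frobenius

noncomputable section

/-- The trace inner product `⟪X, Y⟫ = tr (Xᵀ Y)`, whose norm is the Frobenius norm `‖X‖`. -/
instance frobeniusInnerProductSpace {m n : Type*} [Fintype m] [Fintype n] :
    InnerProductSpace ℝ (Matrix m n ℝ) where
  inner X Y := (Xᵀ * Y).trace
  norm_sq_eq_re_inner X := by
    have h : ‖X‖ ^ 2 = ∑ i, ∑ j, X i j ^ 2 := by
      rw [Matrix.frobenius_norm_def, ← Real.sqrt_eq_rpow,
        Real.sq_sqrt (by positivity)]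
      simp
    rw [h, Finset.sum_comm]
    simp [Matrix.trace, Matrix.mul_apply, sq]
  conj_inner_symm X Y := by
    simp [Matrix.trace, Matrix.mul_apply, mul_comm]
  add_left X Y Z := by
    simp [Matrix.add_mul]
  smul_left X Y c := by
    simp

/-- The linear map `𝒜(X) = (⟪A₁, X⟫, …, ⟪Aₙ, X⟫)` of the measurement matrices `A₁, …, Aₙ`.
With the Frobenius inner product on matrices its adjoint `𝒜*` is `LinearMap.adjoint`. -/
def measurementMap {p₁ p₂ n : ℕ} (A : Fin n → Matrix (Fin p₁) (Fin p₂) ℝ) :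
    Matrix (Fin p₁) (Fin p₂) ℝ →ₗ[ℝ] EuclideanSpace ℝ (Fin n) where
  toFun X := WithLp.toLp 2 fun i => inner ℝ (A i) X
  map_add' X Y := by ext i; simp [inner_add_right]
  map_smul' c X := by ext i; simp [inner_smul_right]

/-- The objective `f(X) = ½ ‖y - 𝒜(X)‖₂²`. -/
def objective {p₁ p₂ n : ℕ} (A : Fin n → Matrix (Fin p₁) (Fin p₂) ℝ)
    (y : EuclideanSpace ℝ (Fin n)) (X : Matrix (Fin p₁) (Fin p₂) ℝ) : ℝ :=
  1 / 2 * ‖y - measurementMap A X‖ ^ 2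

/-- The `k`-restricted isometry constant `R_k`: the smallest `R` such that
`(1 - R) ‖Z‖² ≤ ‖𝒜(Z)‖² ≤ (1 + R) ‖Z‖²` for all `Z` of rank at most `k`. -/
def ripConst {p₁ p₂ n : ℕ} (A : Fin n → Matrix (Fin p₁) (Fin p₂) ℝ) (k : ℕ) : ℝ :=
  sInf {R : ℝ | ∀ Z : Matrix (Fin p₁) (Fin p₂) ℝ, Z.rank ≤ k →
    (1 - R) * ‖Z‖ ^ 2 ≤ ‖measurementMap A Z‖ ^ 2 ∧
      ‖measurementMap A Z‖ ^ 2 ≤ (1 + R) * ‖Z‖ ^ 2}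

/-- The `k`-restricted isometry property. -/
def HasRIP {p₁ p₂ n : ℕ} (A : Fin n → Matrix (Fin p₁) (Fin p₂) ℝ) (k : ℕ) : Prop :=
  0 ≤ ripConst A k ∧ ripConst A k < 1

/-- `σ_k(X)`, the `k`-th largest singular value, `k = 1, 2, …`. -/
def sigma {p₁ p₂ : ℕ} (k : ℕ) (X : Matrix (Fin p₁) (Fin p₂) ℝ) : ℝ :=
  (Matrix.toEuclideanLin X).singularValues (k - 1)

/-- `X = U diag(s) Vᵀ` is a singular value decomposition of `X` with `r` terms. -/
structure IsSVD {p₁ p₂ r : ℕ} (X : Matrix (Fin p₁) (Fin p₂) ℝ)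
    (U : Matrix (Fin p₁) (Fin r) ℝ) (s : Fin r → ℝ) (V : Matrix (Fin p₂) (Fin r) ℝ) : Prop where
  orth_left : Uᵀ * U = 1
  orth_right : Vᵀ * V = 1
  nonneg : ∀ i, 0 ≤ s i
  antitone : Antitone s
  eq : X = U * Matrix.diagonal s * Vᵀ

/-- `Up` is an orthonormal complement of `U`: together the columns of `U` and `Up` form an
orthonormal basis of `ℝᵖ`. -/
structure IsOrthComplement {p r : ℕ} (U : Matrix (Fin p) (Fin r) ℝ)
    (Up : Matrix (Fin p) (Fin (p - r)) ℝ) : Prop where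
  orth : Upᵀ * Up = 1
  perp : Uᵀ * Up = 0

/-- `Q` is the `Q`-part of a (thin) QR decomposition of `X`. -/
def IsQRFactor {p r : ℕ} (X Q : Matrix (Fin p) (Fin r) ℝ) : Prop :=
  Qᵀ * Q = 1 ∧ ∃ R : Matrix (Fin r) (Fin r) ℝ, (∀ i j, j < i → R i j = 0) ∧ X = Q * R

/-- `P` is the Moore–Penrose inverse of `M`. -/
structure IsMoorePenrose {m n : ℕ} (M : Matrix (Fin m) (Fin n) ℝ)
    (P : Matrix (Fin n) (Fin m) ℝ) : Prop where
  mul_mul_self : M * P * M = M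
  self_mul_mul : P * M * P = P
  symm_left : (M * P)ᵀ = M * P
  symm_right : (P * M)ᵀ = P * M

/-- A rank `r` matrix `X` is a stationary point of `min f` subject to `rank = r` if
`∇f(X)ᵀ U = 0` and `∇f(X) V = 0`, where `∇f(X) = 𝒜*(𝒜(X) - y)` and `U`, `V` are the left and right
singular vectors of `X`. -/
def IsStationaryPoint {p₁ p₂ n : ℕ} (A : Fin n → Matrix (Fin p₁) (Fin p₂) ℝ)
    (y : EuclideanSpace ℝ (Fin n)) (r : ℕ) (X : Matrix (Fin p₁) (Fin p₂) ℝ) : Prop :=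
  X.rank = r ∧ ∃ (U : Matrix (Fin p₁) (Fin r) ℝ) (s : Fin r → ℝ) (V : Matrix (Fin p₂) (Fin r) ℝ),
    IsSVD X U s V ∧
    (LinearMap.adjoint (measurementMap A) (measurementMap A X - y))ᵀ * U = 0 ∧
    LinearMap.adjoint (measurementMap A) (measurementMap A X - y) * V = 0

/-- The sketched map `M ↦ (⟪M, Lᵀ Aᵢ R⟫)ᵢ`. -/
def sketch {p₁ p₂ n a b : ℕ} (A : Fin n → Matrix (Fin p₁) (Fin p₂) ℝ)
    (L : Matrix (Fin p₁) (Fin a) ℝ) (R : Matrix (Fin p₂) (Fin b) ℝ)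
    (M : Matrix (Fin a) (Fin b) ℝ) : EuclideanSpace ℝ (Fin n) :=
  WithLp.toLp 2 fun i => inner ℝ M (Lᵀ * A i * R)

/-- The objective `‖y - 𝒜_B(B) - 𝒜_{D₁}(D₁) - 𝒜_{D₂}(D₂ᵀ)‖²` of the sketched least squares problem
with sketching matrices `U`, `V` and orthonormal complements `Up`, `Vp`. -/
def sketchedLoss {p₁ p₂ n r : ℕ} (A : Fin n → Matrix (Fin p₁) (Fin p₂) ℝ)
    (y : EuclideanSpace ℝ (Fin n))
    (U : Matrix (Fin p₁) (Fin r) ℝ) (Up : Matrix (Fin p₁) (Fin (p₁ - r)) ℝ)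
    (V : Matrix (Fin p₂) (Fin r) ℝ) (Vp : Matrix (Fin p₂) (Fin (p₂ - r)) ℝ)
    (B : Matrix (Fin r) (Fin r) ℝ) (D₁ : Matrix (Fin (p₁ - r)) (Fin r) ℝ)
    (D₂ : Matrix (Fin (p₂ - r)) (Fin r) ℝ) : ℝ :=
  ‖y - sketch A U V B - sketch A Up V D₁ - sketch A U Vp D₂ᵀ‖ ^ 2

/-- A run of the RISRO algorithm with input `𝒜`, `y`, `r` and initialization `X 0`, including all
its choices (orthonormal complements, minimizers, QR factors). The index of `B`, `D₁`, `D₂` is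
shifted: `B t`, `D₁ t`, `D₂ t` are the minimizers `Bᵗ⁺¹`, `D₁ᵗ⁺¹`, `D₂ᵗ⁺¹` computed in
iteration `t`. -/
structure RISRORun {p₁ p₂ n : ℕ} (A : Fin n → Matrix (Fin p₁) (Fin p₂) ℝ)
    (y : EuclideanSpace ℝ (Fin n)) (r : ℕ) where
  X : ℕ → Matrix (Fin p₁) (Fin p₂) ℝ
  U : ℕ → Matrix (Fin p₁) (Fin r) ℝ
  Up : ℕ → Matrix (Fin p₁) (Fin (p₁ - r)) ℝ
  V : ℕ → Matrix (Fin p₂) (Fin r) ℝ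
  Vp : ℕ → Matrix (Fin p₂) (Fin (p₂ - r)) ℝ
  B : ℕ → Matrix (Fin r) (Fin r) ℝ
  D₁ : ℕ → Matrix (Fin (p₁ - r)) (Fin r) ℝ
  D₂ : ℕ → Matrix (Fin (p₂ - r)) (Fin r) ℝ
  init : ∃ s : Fin r → ℝ, IsSVD (X 0) (U 0) s (V 0)
  compl_left : ∀ t, IsOrthComplement (U t) (Up t)
  compl_right : ∀ t, IsOrthComplement (V t) (Vp t)
  least_squares : ∀ t B' D₁' D₂',
    sketchedLoss A y (U t) (Up t) (V t) (Vp t) (B t) (D₁ t) (D₂ t) ≤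
      sketchedLoss A y (U t) (Up t) (V t) (Vp t) B' D₁' D₂'
  qr_left : ∀ t, IsQRFactor (U t * B t + Up t * D₁ t) (U (t + 1))
  qr_right : ∀ t, IsQRFactor (V t * (B t)ᵀ + Vp t * D₂ t) (V (t + 1))
  update : ∀ t, ∃ P, IsMoorePenrose (B t) P ∧
    X (t + 1) = (U t * B t + Up t * D₁ t) * P * (V t * (B t)ᵀ + Vp t * D₂ t)ᵀ

/-- The matrix `[U Up] [B C; D E] [V Vp]ᵀ`. -/
def assemble {p₁ p₂ r : ℕ}
    (U : Matrix (Fin p₁) (Fin r) ℝ) (Up : Matrix (Fin p₁) (Fin (p₁ - r)) ℝ)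
    (V : Matrix (Fin p₂) (Fin r) ℝ) (Vp : Matrix (Fin p₂) (Fin (p₂ - r)) ℝ)
    (B : Matrix (Fin r) (Fin r) ℝ) (C : Matrix (Fin r) (Fin (p₂ - r)) ℝ)
    (D : Matrix (Fin (p₁ - r)) (Fin r) ℝ) (E : Matrix (Fin (p₁ - r)) (Fin (p₂ - r)) ℝ) :
    Matrix (Fin p₁) (Fin p₂) ℝ :=
  Matrix.fromCols U Up * Matrix.fromBlocks B C D E * (Matrix.fromCols V Vp)ᵀ

/-- The update direction `ηᵗ` encoded in iteration `t`:
`Xᵗ + ηᵗ = [Uᵗ Uᵗ_⊥] [Bᵗ⁺¹ (D₂ᵗ⁺¹)ᵀ; D₁ᵗ⁺¹ 0] [Vᵗ Vᵗ_⊥]ᵀ`. -/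
def RISRORun.eta {p₁ p₂ n r : ℕ} {A : Fin n → Matrix (Fin p₁) (Fin p₂) ℝ}
    {y : EuclideanSpace ℝ (Fin n)} (run : RISRORun A y r) (t : ℕ) :
    Matrix (Fin p₁) (Fin p₂) ℝ :=
  assemble (run.U t) (run.Up t) (run.V t) (run.Vp t) (run.B t) (run.D₂ t)ᵀ (run.D₁ t) 0 - run.X t

/-- The tangent space at `X` of the manifold `ℳ_r` of matrices of rank `r`, spanned by the
velocities `γ'(0)` of smooth curves `γ` in `ℳ_r` with `γ(0) = X`. -/
def tangentSpace {p₁ p₂ : ℕ} (r : ℕ) (X : Matrix (Fin p₁) (Fin p₂) ℝ) :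
    Submodule ℝ (Matrix (Fin p₁) (Fin p₂) ℝ) :=
  Submodule.span ℝ {Z | ∃ (ε : ℝ) (γ : ℝ → Matrix (Fin p₁) (Fin p₂) ℝ), 0 < ε ∧
    ContDiffOn ℝ ∞ γ (Ioo (-ε) ε) ∧ (∀ s ∈ Ioo (-ε) ε, (γ s).rank = r) ∧
    γ 0 = X ∧ HasDerivAt γ Z 0}

/-- The Riemannian gradient of (the restriction to `ℳ_r` of) `f` at `X`: the unique tangent vector
`G` at `X` with `⟪G, Z⟫ = D f(X)[Z]` for all tangent vectors `Z`. -/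
def riemannianGrad {p₁ p₂ : ℕ} (r : ℕ) (f : Matrix (Fin p₁) (Fin p₂) ℝ → ℝ)
    (X : Matrix (Fin p₁) (Fin p₂) ℝ) : Matrix (Fin p₁) (Fin p₂) ℝ :=
  ((InnerProductSpace.toDual ℝ (tangentSpace r X)).symm
    ((fderiv ℝ f X).comp (tangentSpace r X).subtypeL) : tangentSpace r X)

/-- The orthographic retraction `η ↦ R(X, η)` on `ℳ_r` at `X`, where the columns of `U` and `V` are
orthonormal bases of the column and row spaces of `X`, with orthonormal complements `Up` and `Vp`:
if `X + η = [U Up] [B C; D 0] [V Vp]ᵀ`, then `R(X, η) = [U Up] [B C; D E] [V Vp]ᵀ`, `E = D B⁻¹ C`. -/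
def orthographicRetraction {p₁ p₂ r : ℕ}
    (U : Matrix (Fin p₁) (Fin r) ℝ) (Up : Matrix (Fin p₁) (Fin (p₁ - r)) ℝ)
    (V : Matrix (Fin p₂) (Fin r) ℝ) (Vp : Matrix (Fin p₂) (Fin (p₂ - r)) ℝ)
    (X η : Matrix (Fin p₁) (Fin p₂) ℝ) : Matrix (Fin p₁) (Fin p₂) ℝ :=
  assemble U Up V Vp (Uᵀ * (X + η) * V) (Uᵀ * (X + η) * Vp) (Upᵀ * (X + η) * V)
    ((Upᵀ * (X + η) * V) * (Uᵀ * (X + η) * V)⁻¹ * (Uᵀ * (X + η) * Vp))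

/-- `R` maps a neighbourhood of `0` in the tangent space of `ℳ_r` at `X` smoothly into `ℳ_r`, with
`R(0) = X` and `d/ds R(s η) = η` at `s = 0` for every tangent vector `η`. -/
structure IsRetractionAt {p₁ p₂ : ℕ} (r : ℕ) (X : Matrix (Fin p₁) (Fin p₂) ℝ)
    (R : Matrix (Fin p₁) (Fin p₂) ℝ → Matrix (Fin p₁) (Fin p₂) ℝ) : Prop where
  mapsTo : ∀ᶠ η : tangentSpace r X in 𝓝 0, (R η).rank = r
  smooth : ContDiffAt ℝ ∞ (fun η : tangentSpace r X => R η) 0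
  zero : R 0 = X
  deriv : ∀ η ∈ tangentSpace r X, HasDerivAt (fun s : ℝ => R (s • η)) η 0

end

/-! Write `X = U M Vᵀ` for an iterate and let `T` be the space of matrices `Z` with `U_⊥ᵀ Z V_⊥ =
0`. If `M` is invertible, `X` has rank `r` and `T` is its tangent space
(`IsFrame.mem_tangentSpace_iff`). The sketched problem minimizes `‖y - 𝒜(W)‖` over `W ∈ T`. Since `X
∈ T`, its minimizer has the form `X + η` with `η ∈ T`, and its normal equations are the Gauss–Newton
equation (`IsFrame.normal_equations`, `starProjection_eq_neg_riemannianGrad`). If `B` is invertible,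
`X_U B⁻¹ X_Vᵀ` fills the empty corner with `D B⁻¹ C`; this is the orthographic retraction, and the
added corner is normal to `T`.

It remains to keep `M` and `B` invertible along the whole run. For this it suffices that the
distance to `Xbar` never exceeds its initial value `e ≤ σ/4`, where `σ = σ_r(Xbar)`. Let `P` be the
part of `Xbar` normal to `T` and `E` the minimizer minus the projection `Xbar - P`. The normal
equations give `‖𝒜 E‖² = ⟪𝒜 E, 𝒜 P⟫ + ⟪G, E⟫` with `G = 𝒜*(y - 𝒜 Xbar)`. The RIP bounds the left
side below and the cross term above, `‖P‖ ≤ e²/σ` because the manifold is tangent to second order,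
and stationarity makes `G` almost normal to `T`. This yields `‖E‖ ≤ 5/12 e`
(`IsFrame.norm_tangential_error_le`).

The corners of the new iterate and of `Xbar` are both of the form `D B⁻¹ C` and differ by at most
`7/5 ‖E‖`. The new error is thus at most `(1 + 7/5) · 5/12 e = e` (`IsFrame.step`), which closes the
induction. -/

/-! ### The Frobenius inner product -/

section Frobenius

variable {m n k l : Type*} [Fintype m] [Fintype n] [Fintype k] [Fintype l]

lemma frobenius_inner_eq_trace (X Y : Matrix m n ℝ) : inner ℝ X Y = (Xᵀ * Y).trace := rfl

lemma frobenius_inner_mul_left (L : Matrix m k ℝ) (X : Matrix k n ℝ) (Y : Matrix m n ℝ) :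
    inner ℝ (L * X) Y = inner ℝ X (Lᵀ * Y) := by
  simp only [frobenius_inner_eq_trace, Matrix.transpose_mul, Matrix.mul_assoc]

lemma frobenius_inner_mul_right (X : Matrix m k ℝ) (R : Matrix k n ℝ) (Y : Matrix m n ℝ) :
    inner ℝ (X * R) Y = inner ℝ X (Y * Rᵀ) := by
  simp only [frobenius_inner_eq_trace, Matrix.transpose_mul, Matrix.mul_assoc]
  rw [Matrix.trace_mul_comm, Matrix.mul_assoc]

lemma isBoundedBilinearMap_matrix_mul :
    IsBoundedBilinearMap ℝ (fun p : Matrix m k ℝ × Matrix k n ℝ => p.1 * p.2) where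
  add_left _ _ _ := Matrix.add_mul _ _ _
  smul_left _ _ _ := Matrix.smul_mul _ _ _
  add_right _ _ _ := Matrix.mul_add _ _ _
  smul_right _ _ _ := Matrix.mul_smul _ _ _
  bound := ⟨1, one_pos, fun X Y => by simpa using Matrix.frobenius_norm_mul X Y⟩

variable [DecidableEq k]

lemma frobenius_norm_mul_of_orthonormal {U : Matrix m k ℝ} (hU : Uᵀ * U = 1) (N : Matrix k n ℝ) :
    ‖U * N‖ = ‖N‖ := by
  rw [← sq_eq_sq₀ (norm_nonneg _) (norm_nonneg _), ← real_inner_self_eq_norm_sq,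
    ← real_inner_self_eq_norm_sq, frobenius_inner_mul_left, ← Matrix.mul_assoc, hU, Matrix.one_mul]

lemma frobenius_norm_mul_transpose_of_orthonormal {V : Matrix m k ℝ} (hV : Vᵀ * V = 1)
    (N : Matrix n k ℝ) : ‖N * Vᵀ‖ = ‖N‖ := by
  rw [← Matrix.frobenius_norm_transpose, Matrix.transpose_mul, Matrix.transpose_transpose,
    frobenius_norm_mul_of_orthonormal hV, Matrix.frobenius_norm_transpose]

/-- Cauchy–Schwarz applied to `‖UᵀN‖² = ⟪U UᵀN, N⟫`, together with `‖U UᵀN‖ = ‖UᵀN‖`. -/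
lemma frobenius_norm_transpose_mul_le {U : Matrix m k ℝ} (hU : Uᵀ * U = 1) (N : Matrix m n ℝ) :
    ‖Uᵀ * N‖ ≤ ‖N‖ := by
  have h : ‖Uᵀ * N‖ * ‖Uᵀ * N‖ ≤ ‖Uᵀ * N‖ * ‖N‖ := by
    rw [← real_inner_self_eq_norm_mul_norm, ← frobenius_inner_mul_left,
      ← frobenius_norm_mul_of_orthonormal hU (Uᵀ * N)]
    exact real_inner_le_norm _ _
  by_contra! hlt
  nlinarith [norm_nonneg N]

lemma frobenius_norm_mul_le_of_orthonormal {V : Matrix m k ℝ} (hV : Vᵀ * V = 1)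
    (N : Matrix n m ℝ) : ‖N * V‖ ≤ ‖N‖ := by
  rw [← Matrix.frobenius_norm_transpose, Matrix.transpose_mul, ← Matrix.frobenius_norm_transpose N]
  exact frobenius_norm_transpose_mul_le hV _

end Frobenius

/-! ### Square matrices bounded below -/

/-- All singular values of the square matrix `B` are at least `c`: left and right multiplication
by `B` expand the Frobenius norm at least by the factor `c`. -/
structure IsBoundedBelow {r : ℕ} (c : ℝ) (B : Matrix (Fin r) (Fin r) ℝ) : Prop where
  left : ∀ {k : ℕ} (N : Matrix (Fin r) (Fin k) ℝ), c * ‖N‖ ≤ ‖B * N‖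
  right : ∀ {k : ℕ} (N : Matrix (Fin k) (Fin r) ℝ), c * ‖N‖ ≤ ‖N * B‖

namespace IsBoundedBelow

variable {r : ℕ} {c d : ℝ} {B : Matrix (Fin r) (Fin r) ℝ}

lemma mono (hB : IsBoundedBelow c B) (h : d ≤ c) : IsBoundedBelow d B :=
  ⟨fun N => (mul_le_mul_of_nonneg_right h (norm_nonneg N)).trans (hB.left N),
    fun N => (mul_le_mul_of_nonneg_right h (norm_nonneg N)).trans (hB.right N)⟩

lemma add (hB : IsBoundedBelow c B) {Δ : Matrix (Fin r) (Fin r) ℝ} (hΔ : ‖Δ‖ ≤ d) :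
    IsBoundedBelow (c - d) (B + Δ) := by
  refine ⟨fun N => ?_, fun N => ?_⟩
  · have h1 := hB.left N
    have h2 := Matrix.frobenius_norm_mul Δ N
    have h3 := norm_sub_le (B * N + Δ * N) (Δ * N)
    rw [add_sub_cancel_right] at h3
    rw [Matrix.add_mul]
    nlinarith [mul_le_mul_of_nonneg_right hΔ (norm_nonneg N)]
  · have h1 := hB.right N
    have h2 := Matrix.frobenius_norm_mul N Δ
    have h3 := norm_sub_le (N * B + N * Δ) (N * Δ)
    rw [add_sub_cancel_right] at h3
    rw [Matrix.mul_add]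
    nlinarith [mul_le_mul_of_nonneg_right hΔ (norm_nonneg N)]

lemma isUnit (hB : IsBoundedBelow c B) (hc : 0 < c) : IsUnit B := by
  rw [← Matrix.mulVec_injective_iff_isUnit]
  refine (injective_iff_map_eq_zero (Matrix.mulVecLin B)).2 fun v hv => ?_
  have h := hB.left (Matrix.replicateCol (Fin 1) v)
  rw [← Matrix.replicateCol_mulVec] at h
  rw [show B *ᵥ v = 0 from hv, show Matrix.replicateCol (Fin 1) (0 : Fin r → ℝ) = 0 from rfl,
    norm_zero] at h
  have h0 : ‖Matrix.replicateCol (Fin 1) v‖ = 0 := by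
    nlinarith [norm_nonneg (Matrix.replicateCol (Fin 1) v)]
  rw [norm_eq_zero] at h0
  funext i
  exact congr_fun (congr_fun h0 i) 0

lemma norm_inv_mul_le (hB : IsBoundedBelow c B) (hc : 0 < c) {k : ℕ}
    (N : Matrix (Fin r) (Fin k) ℝ) : ‖B⁻¹ * N‖ ≤ ‖N‖ / c := by
  have h := hB.left (B⁻¹ * N)
  rw [Matrix.mul_nonsing_inv_cancel_left _ _ ((Matrix.isUnit_iff_isUnit_det B).1 (hB.isUnit hc))] at h
  rw [le_div_iff₀ hc]
  linarith

lemma norm_mul_inv_le (hB : IsBoundedBelow c B) (hc : 0 < c) {k : ℕ}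
    (N : Matrix (Fin k) (Fin r) ℝ) : ‖N * B⁻¹‖ ≤ ‖N‖ / c := by
  have h := hB.right (N * B⁻¹)
  rw [Matrix.nonsing_inv_mul_cancel_right _ _ ((Matrix.isUnit_iff_isUnit_det B).1 (hB.isUnit hc))] at h
  rw [le_div_iff₀ hc]
  linarith

lemma diagonal {s : Fin r → ℝ} (hc : 0 ≤ c) (hs : ∀ i, c ≤ s i) :
    IsBoundedBelow c (Matrix.diagonal s) := by
  refine ⟨fun {k} N => ?_, fun {k} N => ?_⟩ <;>
  · rw [Matrix.frobenius_norm_def, Matrix.frobenius_norm_def, ← Real.sqrt_eq_rpow,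
      ← Real.sqrt_eq_rpow, ← Real.sqrt_sq hc, ← Real.sqrt_mul (sq_nonneg c)]
    refine Real.sqrt_le_sqrt ?_
    simp only [Finset.mul_sum]
    refine Finset.sum_le_sum fun i _ => Finset.sum_le_sum fun j _ => ?_
    simp only [Matrix.diagonal_mul, Matrix.mul_diagonal, norm_mul, Real.norm_eq_abs,
      Real.rpow_two, mul_pow, sq_abs]
    first
    | nlinarith [mul_le_mul_of_nonneg_right (pow_le_pow_left₀ hc (hs i) 2) (sq_nonneg (N i j))]
    | nlinarith [mul_le_mul_of_nonneg_right (pow_le_pow_left₀ hc (hs j) 2) (sq_nonneg (N i j))]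

/-- Contractions can only shrink, so a lower bound for `P M Q` is inherited by `M`. Invertibility of
the product forces that of `P` and `Q`, which allows testing the product on `Q⁻¹ N` and `N P⁻¹`,
matrices no smaller than `N`. -/
lemma of_mul_mul {P M Q : Matrix (Fin r) (Fin r) ℝ} (hc : 0 < c)
    (h : IsBoundedBelow c (P * M * Q))
    (hPl : ∀ {k : ℕ} (N : Matrix (Fin r) (Fin k) ℝ), ‖P * N‖ ≤ ‖N‖)
    (hPr : ∀ {k : ℕ} (N : Matrix (Fin k) (Fin r) ℝ), ‖N * P‖ ≤ ‖N‖)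
    (hQl : ∀ {k : ℕ} (N : Matrix (Fin r) (Fin k) ℝ), ‖Q * N‖ ≤ ‖N‖)
    (hQr : ∀ {k : ℕ} (N : Matrix (Fin k) (Fin r) ℝ), ‖N * Q‖ ≤ ‖N‖) :
    IsBoundedBelow c M := by
  have hu := (Matrix.isUnit_iff_isUnit_det _).1 (h.isUnit hc)
  rw [Matrix.det_mul, Matrix.det_mul, IsUnit.mul_iff, IsUnit.mul_iff] at hu
  obtain ⟨⟨hP, hM⟩, hQ⟩ := hu
  refine ⟨fun {k} N => ?_, fun {k} N => ?_⟩
  · have h1 := h.left (Q⁻¹ * N)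
    rw [Matrix.mul_assoc, Matrix.mul_nonsing_inv_cancel_left _ _ hQ, Matrix.mul_assoc] at h1
    have h2 := hQl (Q⁻¹ * N)
    rw [Matrix.mul_nonsing_inv_cancel_left _ _ hQ] at h2
    nlinarith [hPl (M * N)]
  · have h1 := h.right (N * P⁻¹)
    rw [← Matrix.mul_assoc, ← Matrix.mul_assoc, Matrix.nonsing_inv_mul_cancel_right _ _ hP] at h1
    have h2 := hPr (N * P⁻¹)
    rw [Matrix.nonsing_inv_mul_cancel_right _ _ hP] at h2
    nlinarith [hQr (N * M)]

end IsBoundedBelow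

/-! ### Singular values -/

lemma toEuclideanLin_finrank_range {p₁ p₂ : ℕ} (X : Matrix (Fin p₁) (Fin p₂) ℝ) :
    Module.finrank ℝ (Matrix.toEuclideanLin X).range = X.rank := by
  rw [Matrix.rank_eq_finrank_range_toLin X (EuclideanSpace.basisFun _ ℝ).toBasis
    (EuclideanSpace.basisFun _ ℝ).toBasis, Matrix.toEuclideanLin_eq_toLin_orthonormal]

lemma sigma_pos {p₁ p₂ r : ℕ} (hr : 1 ≤ r) {X : Matrix (Fin p₁) (Fin p₂) ℝ} (hX : X.rank = r) :
    0 < sigma r X := by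
  rw [sigma, LinearMap.singularValues_pos_iff_lt_finrank_range, toEuclideanLin_finrank_range]
  omega

lemma IsSVD.singularValue_ne_zero {p₁ p₂ r : ℕ} {X : Matrix (Fin p₁) (Fin p₂) ℝ}
    {U : Matrix (Fin p₁) (Fin r) ℝ} {s : Fin r → ℝ} {V : Matrix (Fin p₂) (Fin r) ℝ}
    (h : IsSVD X U s V) (hX : X.rank = r) (i : Fin r) : s i ≠ 0 := by
  have h1 : r ≤ (Matrix.diagonal s).rank := by
    conv_lhs => rw [← hX, h.eq]
    exact (Matrix.rank_mul_le_left _ _).trans (Matrix.rank_mul_le_right _ _)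
  rw [Matrix.rank_diagonal, Fintype.card_subtype] at h1
  have h2 : (Finset.univ.filter fun i => s i ≠ 0) = Finset.univ := by
    refine Finset.eq_univ_of_card _ (le_antisymm (Finset.card_le_univ _) ?_)
    simpa using h1
  simpa using (Finset.ext_iff.1 h2 i)

/-- Connects an explicit SVD with the spectral definition of singular values without matching
indices or multiplicities. Each `s i ^ 2` is an eigenvalue of `XᵀX`, so `s i` is the singular value
with some index `j`. It is positive, hence `j < r`, and monotonicity finishes. -/
lemma IsSVD.sigma_le {p₁ p₂ r : ℕ} {X : Matrix (Fin p₁) (Fin p₂) ℝ}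
    {U : Matrix (Fin p₁) (Fin r) ℝ} {s : Fin r → ℝ} {V : Matrix (Fin p₂) (Fin r) ℝ}
    (h : IsSVD X U s V) (hX : X.rank = r) (i : Fin r) : sigma r X ≤ s i := by
  set T := Matrix.toEuclideanLin X with hT
  have hadj : LinearMap.adjoint T = Matrix.toEuclideanLin Xᵀ := by
    rw [hT, ← Matrix.toEuclideanLin_conjTranspose_eq_adjoint, Matrix.conjTranspose_eq_transpose_of_trivial]
  have hXX : Xᵀ * X * V = V * Matrix.diagonal (fun j => s j ^ 2) := by
    have : Matrix.diagonal (fun j => s j ^ 2) = Matrix.diagonal s * Matrix.diagonal s := by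
      simp [Matrix.diagonal_mul_diagonal, sq]
    rw [this]
    conv_lhs => rw [h.eq]
    simp only [Matrix.transpose_mul, Matrix.transpose_transpose, Matrix.diagonal_transpose]
    simp only [Matrix.mul_assoc, h.orth_right, Matrix.mul_one]
    rw [← Matrix.mul_assoc Uᵀ U, h.orth_left, Matrix.one_mul]
  have hev : Module.End.HasEigenvalue (LinearMap.adjoint T ∘ₗ T) (s i ^ 2) := by
    refine Module.End.hasEigenvalue_of_hasEigenvector (x := WithLp.toLp 2 (V.col i)) ⟨?_, ?_⟩
    · rw [Module.End.mem_eigenspace_iff, hadj, hT]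
      ext j
      have := congr_fun (congr_fun hXX j) i
      rw [Matrix.mul_diagonal] at this
      simp only [LinearMap.comp_apply, Matrix.toLpLin_toLp, Matrix.toLin'_apply,
        Matrix.mulVec_mulVec, PiLp.smul_apply, smul_eq_mul]
      rw [mul_comm]
      exact this
    · intro h0
      have h1 := congr_fun (congr_fun h.orth_right i) i
      have h2 : ∀ j, V j i = 0 := fun j => congr_arg (fun v : EuclideanSpace ℝ (Fin p₂) => v j) h0
      simp [Matrix.mul_apply, h2] at h1
  obtain ⟨j, hj⟩ := T.isSymmetric_adjoint_comp_self.exists_eigenvalues_eq rfl hev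
  have hj' : T.singularValues j ^ 2 = s i ^ 2 := by
    rw [T.sq_singularValues_fin rfl j]
    exact hj
  have hj'' : T.singularValues j = s i := by
    rwa [sq_eq_sq₀ (T.singularValues_nonneg _) (h.nonneg i)] at hj'
  have hpos : 0 < T.singularValues j := by
    rw [hj'']
    exact lt_of_le_of_ne (h.nonneg i) (h.singularValue_ne_zero hX i).symm
  rw [LinearMap.singularValues_pos_iff_lt_finrank_range, toEuclideanLin_finrank_range, hX] at hpos
  rw [← hj'']
  exact T.singularValues_antitone (by omega)

/-! ### Block decompositions -/

lemma IsOrthComplement.mul_transpose_add {p r : ℕ} {U : Matrix (Fin p) (Fin r) ℝ}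
    {Up : Matrix (Fin p) (Fin (p - r)) ℝ} (h : IsOrthComplement U Up) (hU : Uᵀ * U = 1) :
    U * Uᵀ + Up * Upᵀ = 1 := by
  -- Needed because `p - r` is truncated: only for `r ≤ p` is `[U Up]` square, so that its left
  -- inverse is also a right inverse.
  have hrp : r ≤ p := by
    have h1 : (Uᵀ * U).rank = r := by rw [hU, Matrix.rank_one, Fintype.card_fin]
    have h2 := (Matrix.rank_mul_le_right Uᵀ U).trans (Matrix.rank_le_height U)
    omega
  have h1 : (Matrix.fromCols U Up)ᵀ * Matrix.fromCols U Up = 1 := by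
    rw [Matrix.transpose_fromCols, Matrix.fromRows_mul_fromCols, hU, h.orth, h.perp,
      ← Matrix.transpose_transpose (Upᵀ * U), Matrix.transpose_mul, Matrix.transpose_transpose,
      h.perp, Matrix.transpose_zero, Matrix.fromBlocks_one]
  have h2 := (Matrix.mul_eq_one_comm_of_card_eq _ _ _ (by simp [hrp])).1 h1
  rwa [Matrix.transpose_fromCols, Matrix.fromCols_mul_fromRows] at h2

lemma IsOrthComplement.perp' {p r : ℕ} {U : Matrix (Fin p) (Fin r) ℝ}
    {Up : Matrix (Fin p) (Fin (p - r)) ℝ} (h : IsOrthComplement U Up) : Upᵀ * U = 0 := by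
  rw [← Matrix.transpose_transpose (Upᵀ * U), Matrix.transpose_mul, Matrix.transpose_transpose,
    h.perp, Matrix.transpose_zero]

lemma assemble_eq {p₁ p₂ r : ℕ}
    (U : Matrix (Fin p₁) (Fin r) ℝ) (Up : Matrix (Fin p₁) (Fin (p₁ - r)) ℝ)
    (V : Matrix (Fin p₂) (Fin r) ℝ) (Vp : Matrix (Fin p₂) (Fin (p₂ - r)) ℝ)
    (B : Matrix (Fin r) (Fin r) ℝ) (C : Matrix (Fin r) (Fin (p₂ - r)) ℝ)
    (D : Matrix (Fin (p₁ - r)) (Fin r) ℝ) (E : Matrix (Fin (p₁ - r)) (Fin (p₂ - r)) ℝ) :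
    assemble U Up V Vp B C D E =
      U * B * Vᵀ + U * C * Vpᵀ + Up * D * Vᵀ + Up * E * Vpᵀ := by
  rw [assemble, Matrix.fromCols_mul_fromBlocks, Matrix.transpose_fromCols,
    Matrix.fromCols_mul_fromRows, Matrix.add_mul, Matrix.add_mul]
  abel

/-- `U`, `V` have orthonormal columns and `Up`, `Vp` are orthonormal complements of them. -/
structure IsFrame {p₁ p₂ r : ℕ}
    (U : Matrix (Fin p₁) (Fin r) ℝ) (Up : Matrix (Fin p₁) (Fin (p₁ - r)) ℝ)
    (V : Matrix (Fin p₂) (Fin r) ℝ) (Vp : Matrix (Fin p₂) (Fin (p₂ - r)) ℝ) : Prop where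
  orth_left : Uᵀ * U = 1
  orth_right : Vᵀ * V = 1
  compl_left : IsOrthComplement U Up
  compl_right : IsOrthComplement V Vp

namespace IsFrame

variable {p₁ p₂ r : ℕ}
    {U : Matrix (Fin p₁) (Fin r) ℝ} {Up : Matrix (Fin p₁) (Fin (p₁ - r)) ℝ}
    {V : Matrix (Fin p₂) (Fin r) ℝ} {Vp : Matrix (Fin p₂) (Fin (p₂ - r)) ℝ}

lemma assemble_self (h : IsFrame U Up V Vp) (W : Matrix (Fin p₁) (Fin p₂) ℝ) :
    assemble U Up V Vp (Uᵀ * W * V) (Uᵀ * W * Vp) (Upᵀ * W * V) (Upᵀ * W * Vp) = W := by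
  have h1 := h.compl_left.mul_transpose_add h.orth_left
  have h2 := h.compl_right.mul_transpose_add h.orth_right
  calc _ = (U * Uᵀ + Up * Upᵀ) * W * (V * Vᵀ + Vp * Vpᵀ) := by
        rw [assemble_eq]
        simp only [Matrix.add_mul, Matrix.mul_add, Matrix.mul_assoc]
        abel
    _ = W := by rw [h1, h2, Matrix.one_mul, Matrix.mul_one]

lemma blocks_assemble (h : IsFrame U Up V Vp)
    (B : Matrix (Fin r) (Fin r) ℝ) (C : Matrix (Fin r) (Fin (p₂ - r)) ℝ)
    (D : Matrix (Fin (p₁ - r)) (Fin r) ℝ) (E : Matrix (Fin (p₁ - r)) (Fin (p₂ - r)) ℝ) :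
    Uᵀ * assemble U Up V Vp B C D E * V = B ∧ Uᵀ * assemble U Up V Vp B C D E * Vp = C ∧
      Upᵀ * assemble U Up V Vp B C D E * V = D ∧ Upᵀ * assemble U Up V Vp B C D E * Vp = E := by
  have a1 : ∀ {k : ℕ} (N : Matrix (Fin r) (Fin k) ℝ), Uᵀ * (U * N) = N := fun N => by
    rw [← Matrix.mul_assoc, h.orth_left, Matrix.one_mul]
  have a2 : ∀ {k : ℕ} (N : Matrix (Fin (p₁ - r)) (Fin k) ℝ), Uᵀ * (Up * N) = 0 := fun N => by
    rw [← Matrix.mul_assoc, h.compl_left.perp, Matrix.zero_mul]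
  have a3 : ∀ {k : ℕ} (N : Matrix (Fin r) (Fin k) ℝ), Upᵀ * (U * N) = 0 := fun N => by
    rw [← Matrix.mul_assoc, h.compl_left.perp', Matrix.zero_mul]
  have a4 : ∀ {k : ℕ} (N : Matrix (Fin (p₁ - r)) (Fin k) ℝ), Upᵀ * (Up * N) = N := fun N => by
    rw [← Matrix.mul_assoc, h.compl_left.orth, Matrix.one_mul]
  rw [assemble_eq]
  refine ⟨?_, ?_, ?_, ?_⟩ <;>
  simp only [Matrix.mul_add, Matrix.add_mul, Matrix.mul_assoc, h.orth_right, h.compl_right.perp,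
    h.compl_right.perp', h.compl_right.orth, Matrix.mul_one, Matrix.mul_zero, a1, a2, a3, a4,
    add_zero, zero_add]

lemma norm_sq_eq (h : IsFrame U Up V Vp) (W : Matrix (Fin p₁) (Fin p₂) ℝ) :
    ‖W‖ ^ 2 = ‖Uᵀ * W * V‖ ^ 2 + ‖Uᵀ * W * Vp‖ ^ 2 + ‖Upᵀ * W * V‖ ^ 2
      + ‖Upᵀ * W * Vp‖ ^ 2 := by
  have h1 := h.compl_left.mul_transpose_add h.orth_left
  have h2 := h.compl_right.mul_transpose_add h.orth_right
  have key : ∀ {k : ℕ} (N : Matrix (Fin k) (Fin p₂) ℝ),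
      ‖N * V‖ ^ 2 + ‖N * Vp‖ ^ 2 = ‖N‖ ^ 2 := fun N => by
    rw [← real_inner_self_eq_norm_sq, ← real_inner_self_eq_norm_sq, ← real_inner_self_eq_norm_sq,
      frobenius_inner_mul_right, frobenius_inner_mul_right, ← inner_add_right, Matrix.mul_assoc,
      Matrix.mul_assoc, ← Matrix.mul_add, h2, Matrix.mul_one]
  have key2 : ‖Uᵀ * W‖ ^ 2 + ‖Upᵀ * W‖ ^ 2 = ‖W‖ ^ 2 := by
    rw [← real_inner_self_eq_norm_sq, ← real_inner_self_eq_norm_sq, ← real_inner_self_eq_norm_sq,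
      frobenius_inner_mul_left, frobenius_inner_mul_left, ← inner_add_right,
      Matrix.transpose_transpose, Matrix.transpose_transpose, ← Matrix.mul_assoc,
      ← Matrix.mul_assoc, ← Matrix.add_mul, h1, Matrix.one_mul]
  rw [← key2, ← key, ← key]
  ring

end IsFrame

/-! ### Matrices of rank `r` with an invertible block -/

lemma le_rank_of_isUnit {p₁ p₂ r : ℕ} {L : Matrix (Fin r) (Fin p₁) ℝ}
    {X : Matrix (Fin p₁) (Fin p₂) ℝ} {R : Matrix (Fin p₂) (Fin r) ℝ}
    (h : IsUnit (L * X * R)) : r ≤ X.rank := by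
  have h1 := Matrix.rank_of_isUnit _ h
  rw [Fintype.card_fin] at h1
  have h2 := (Matrix.rank_mul_le_left (L * X) R).trans (Matrix.rank_mul_le_right L X)
  omega

lemma rank_mul_le_of_mid {p₁ p₂ r : ℕ} (P : Matrix (Fin p₁) (Fin r) ℝ)
    (Q : Matrix (Fin r) (Fin p₂) ℝ) : (P * Q).rank ≤ r :=
  (Matrix.rank_mul_le_right P Q).trans (Matrix.rank_le_height Q)

/-- The columns of `X R` already span the range of `X`, so `X = X R K`; multiplying by `L`
determines `K`. Compressed to the complements, this says that a rank `r` matrix with invertible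
leading block `B` has last block `D B⁻¹ C`. -/
lemma eq_mul_inv_mul_of_rank {p₁ p₂ r : ℕ} {L : Matrix (Fin r) (Fin p₁) ℝ}
    {X : Matrix (Fin p₁) (Fin p₂) ℝ} {R : Matrix (Fin p₂) (Fin r) ℝ}
    (hX : X.rank = r) (h : IsUnit (L * X * R)) : X = X * R * (L * X * R)⁻¹ * (L * X) := by
  have hle : (X * R).mulVecLin.range ≤ X.mulVecLin.range := by
    rw [Matrix.mulVecLin_mul]
    exact LinearMap.range_comp_le_range _ _
  have hrk : (X * R).rank = r := by
    refine le_antisymm ((Matrix.rank_mul_le_left X R).trans hX.le) ?_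
    have h1 := Matrix.rank_of_isUnit _ h
    rw [Fintype.card_fin] at h1
    rw [Matrix.mul_assoc] at h1
    have h2 := Matrix.rank_mul_le_right L (X * R)
    omega
  have heq : (X * R).mulVecLin.range = X.mulVecLin.range :=
    Submodule.eq_of_le_of_finrank_eq hle (hrk.trans hX.symm)
  have hcol : ∀ j, ∃ k : Fin r → ℝ, (X * R) *ᵥ k = X.col j := fun j => by
    have : X.col j ∈ (X * R).mulVecLin.range := by
      rw [heq]
      exact ⟨Pi.single j 1, by simp⟩
    exact this
  choose K hK using hcol
  have hXK : X = X * R * (Matrix.of K)ᵀ := by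
    ext i j
    exact (congr_fun (hK j) i).symm
  have hLX : L * X = L * X * R * (Matrix.of K)ᵀ := by
    conv_lhs => rw [hXK]
    simp only [Matrix.mul_assoc]
  have hinv : (L * X * R)⁻¹ * (L * X) = (Matrix.of K)ᵀ :=
    (congr_arg ((L * X * R)⁻¹ * ·) hLX).trans
      (Matrix.nonsing_inv_mul_cancel_left _ _ ((Matrix.isUnit_iff_isUnit_det _).1 h))
  rw [Matrix.mul_assoc (X * R), hinv]
  exact hXK

noncomputable section

/-! ### The orthographic retraction and the tangent space -/

/-- The linear map `W ↦ L W R`. -/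
def mulMulCLM {p₁ p₂ a b : ℕ} (L : Matrix (Fin a) (Fin p₁) ℝ) (R : Matrix (Fin p₂) (Fin b) ℝ) :
    Matrix (Fin p₁) (Fin p₂) ℝ →L[ℝ] Matrix (Fin a) (Fin b) ℝ :=
  LinearMap.toContinuousLinearMap
    { toFun := fun W => L * W * R
      map_add' := fun W W' => by rw [Matrix.mul_add, Matrix.add_mul]
      map_smul' := fun c W => by simp }

@[simp]
lemma mulMulCLM_apply {p₁ p₂ a b : ℕ} (L : Matrix (Fin a) (Fin p₁) ℝ)
    (R : Matrix (Fin p₂) (Fin b) ℝ) (W : Matrix (Fin p₁) (Fin p₂) ℝ) :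
    mulMulCLM L R W = L * W * R := rfl

lemma contDiffAt_matrix_inv {r : ℕ} {B : Matrix (Fin r) (Fin r) ℝ} (hB : IsUnit B) :
    ContDiffAt ℝ ∞ (fun B : Matrix (Fin r) (Fin r) ℝ => B⁻¹) B := by
  obtain ⟨u, rfl⟩ := hB
  have : (fun B : Matrix (Fin r) (Fin r) ℝ => B⁻¹) = Ring.inverse := by
    funext B
    exact Matrix.nonsing_inv_eq_ringInverse B
  rw [this]
  exact contDiffAt_ringInverse ℝ u

/-- The second order part `W ↦ U_⊥ D B⁻¹ C V_⊥ᵀ` of the orthographic retraction at `X`, where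
`B = Uᵀ (X + W) V`, `C = Uᵀ W V_⊥`, `D = U_⊥ᵀ W V`. -/
def orthographicCorrection {p₁ p₂ r : ℕ}
    (U : Matrix (Fin p₁) (Fin r) ℝ) (Up : Matrix (Fin p₁) (Fin (p₁ - r)) ℝ)
    (V : Matrix (Fin p₂) (Fin r) ℝ) (Vp : Matrix (Fin p₂) (Fin (p₂ - r)) ℝ)
    (X W : Matrix (Fin p₁) (Fin p₂) ℝ) : Matrix (Fin p₁) (Fin p₂) ℝ :=
  Up * ((Upᵀ * W * V) * (Uᵀ * (X + W) * V)⁻¹ * (Uᵀ * W * Vp)) * Vpᵀ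

section

variable {p₁ p₂ r : ℕ}
    {U : Matrix (Fin p₁) (Fin r) ℝ} {Up : Matrix (Fin p₁) (Fin (p₁ - r)) ℝ}
    {V : Matrix (Fin p₂) (Fin r) ℝ} {Vp : Matrix (Fin p₂) (Fin (p₂ - r)) ℝ}
    {X : Matrix (Fin p₁) (Fin p₂) ℝ} {M : Matrix (Fin r) (Fin r) ℝ}

lemma contDiffAt_orthographicCorrection {W : Matrix (Fin p₁) (Fin p₂) ℝ}
    (hW : IsUnit (Uᵀ * (X + W) * V)) :
    ContDiffAt ℝ ∞ (orthographicCorrection U Up V Vp X) W := by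
  have hinv : ContDiffAt ℝ ∞ (fun W => (Uᵀ * (X + W) * V)⁻¹) W :=
    (contDiffAt_matrix_inv hW).comp W
      ((mulMulCLM Uᵀ V).contDiff.comp (contDiff_const.add contDiff_id)).contDiffAt
  have hD : ContDiffAt ℝ ∞ (fun W => Upᵀ * W * V) W := (mulMulCLM Upᵀ V).contDiff.contDiffAt
  have hC : ContDiffAt ℝ ∞ (fun W => Uᵀ * W * Vp) W := (mulMulCLM Uᵀ Vp).contDiff.contDiffAt
  have h1 := isBoundedBilinearMap_matrix_mul.contDiff.contDiffAt.comp W (hD.prodMk hinv)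
  have h2 := isBoundedBilinearMap_matrix_mul.contDiff.contDiffAt.comp W (h1.prodMk hC)
  exact (mulMulCLM Up Vpᵀ).contDiff.contDiffAt.comp W h2

namespace IsFrame

lemma left_block_zero (h : IsFrame U Up V Vp) (hX : X = U * M * Vᵀ) : Upᵀ * X = 0 := by
  rw [hX, ← Matrix.mul_assoc, ← Matrix.mul_assoc, h.compl_left.perp', Matrix.zero_mul,
    Matrix.zero_mul]

lemma right_block_zero (h : IsFrame U Up V Vp) (hX : X = U * M * Vᵀ) : X * Vp = 0 := by
  rw [hX, Matrix.mul_assoc, h.compl_right.perp, Matrix.mul_zero]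

lemma middle_block (h : IsFrame U Up V Vp) (hX : X = U * M * Vᵀ) : Uᵀ * X * V = M := by
  rw [hX, Matrix.mul_assoc, Matrix.mul_assoc, h.orth_right, Matrix.mul_one, ← Matrix.mul_assoc,
    h.orth_left, Matrix.one_mul]

/-- `X` lives in the leading block only, so the off-diagonal blocks of `X + W` are those of `W`. The
retraction is thereby a translation plus a term quadratic to leading order. -/
lemma orthographicRetraction_eq (h : IsFrame U Up V Vp) (hX : X = U * M * Vᵀ)
    {W : Matrix (Fin p₁) (Fin p₂) ℝ} (hW : Upᵀ * W * Vp = 0) :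
    orthographicRetraction U Up V Vp X W = X + W + orthographicCorrection U Up V Vp X W := by
  have h1 := h.left_block_zero hX
  have h2 := h.right_block_zero hX
  have h3 : Upᵀ * (X + W) * Vp = 0 := by
    rw [Matrix.mul_add, h1, zero_add, hW]
  have h4 := h.assemble_self (X + W)
  rw [h3, assemble_eq, Matrix.mul_zero, Matrix.zero_mul, add_zero] at h4
  have h5 : Upᵀ * (X + W) = Upᵀ * W := by rw [Matrix.mul_add, h1, zero_add]
  have h6 : Uᵀ * (X + W) * Vp = Uᵀ * W * Vp := by
    rw [Matrix.mul_add, Matrix.add_mul, Matrix.mul_assoc Uᵀ X, h2, Matrix.mul_zero, zero_add]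
  rw [orthographicRetraction, assemble_eq, h4, orthographicCorrection, h5, h6]

lemma rank_orthographicRetraction (h : IsFrame U Up V Vp)
    {W : Matrix (Fin p₁) (Fin p₂) ℝ} (hW : IsUnit (Uᵀ * (X + W) * V)) :
    (orthographicRetraction U Up V Vp X W).rank = r := by
  refine le_antisymm ?_ ?_
  · set B := Uᵀ * (X + W) * V with hB
    have hu := (Matrix.isUnit_iff_isUnit_det _).1 hW
    -- The corner `D B⁻¹ C` makes the Schur complement vanish, so the matrix factors through
    -- dimension `r`.
    have : orthographicRetraction U Up V Vp X W =
        (U * B + Up * (Upᵀ * (X + W) * V)) * (Vᵀ + B⁻¹ * (Uᵀ * (X + W) * Vp) * Vpᵀ) := by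
      rw [orthographicRetraction, assemble_eq, ← hB]
      generalize Uᵀ * (X + W) * Vp = C, Upᵀ * (X + W) * V = D
      rw [Matrix.add_mul, Matrix.mul_add, Matrix.mul_add]
      have : U * B * (B⁻¹ * C * Vpᵀ) = U * C * Vpᵀ := by
        rw [Matrix.mul_assoc B⁻¹, Matrix.mul_assoc U, Matrix.mul_nonsing_inv_cancel_left _ _ hu,
          ← Matrix.mul_assoc U]
      rw [this]
      simp only [Matrix.mul_assoc]
      abel
    rw [this]
    exact rank_mul_le_of_mid _ _
  · refine le_rank_of_isUnit (L := Uᵀ) (R := V) ?_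
    rw [orthographicRetraction, (h.blocks_assemble _ _ _ _).1]
    exact hW

lemma rank_eq (h : IsFrame U Up V Vp) (hX : X = U * M * Vᵀ) (hM : IsUnit M) : X.rank = r := by
  refine le_antisymm ?_ (le_rank_of_isUnit (L := Uᵀ) (R := V) ?_)
  · rw [hX, Matrix.mul_assoc]
    exact rank_mul_le_of_mid _ _
  · rwa [h.middle_block hX]

/-- The factor `s ^ 2` comes from the two linear blocks `C` and `D`. It is why the correction does
not contribute to the velocity at `s = 0`. -/
lemma orthographicCorrection_smul (W : Matrix (Fin p₁) (Fin p₂) ℝ) (s : ℝ) :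
    orthographicCorrection U Up V Vp X (s • W) =
      s ^ 2 • (Up * ((Upᵀ * W * V) * (Uᵀ * (X + s • W) * V)⁻¹ * (Uᵀ * W * Vp)) * Vpᵀ) := by
  rw [orthographicCorrection, sq]
  simp only [Matrix.mul_smul, Matrix.smul_mul, smul_smul]

lemma isOpen_setOf_isUnit_block (X : Matrix (Fin p₁) (Fin p₂) ℝ) (U : Matrix (Fin p₁) (Fin r) ℝ)
    (V : Matrix (Fin p₂) (Fin r) ℝ) :
    IsOpen {W : Matrix (Fin p₁) (Fin p₂) ℝ | IsUnit (Uᵀ * (X + W) * V)} :=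
  Units.isOpen.preimage ((mulMulCLM Uᵀ V).continuous.comp (continuous_const.add continuous_id))

lemma hasDerivAt_curve (h : IsFrame U Up V Vp) (hX : X = U * M * Vᵀ) (hM : IsUnit M)
    (W : Matrix (Fin p₁) (Fin p₂) ℝ) :
    HasDerivAt (fun s : ℝ => X + s • W + orthographicCorrection U Up V Vp X (s • W)) W 0 := by
  have hlin : HasDerivAt (fun s : ℝ => s • W) W 0 :=
    ((hasDerivAt_id (0 : ℝ)).smul_const W).congr_deriv (one_smul ℝ W)
  have hunit : IsUnit (Uᵀ * (X + (0 : ℝ) • W) * V) := by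
    rwa [zero_smul, add_zero, h.middle_block hX]
  have hinv : DifferentiableAt ℝ (fun s : ℝ => (Uᵀ * (X + s • W) * V)⁻¹) 0 := by
    have h1 : DifferentiableAt ℝ (fun s : ℝ => Uᵀ * (X + s • W) * V) 0 :=
      (mulMulCLM Uᵀ V).differentiableAt.comp (0 : ℝ)
        ((differentiableAt_const X).add hlin.differentiableAt)
    exact ((contDiffAt_matrix_inv hunit).differentiableAt (by simp)).comp (0 : ℝ) h1
  have hg : DifferentiableAt ℝ (fun s : ℝ =>
      Up * ((Upᵀ * W * V) * (Uᵀ * (X + s • W) * V)⁻¹ * (Uᵀ * W * Vp)) * Vpᵀ) 0 :=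
    (mulMulCLM Up Vpᵀ).differentiableAt.comp (0 : ℝ)
      ((mulMulCLM (Upᵀ * W * V) (Uᵀ * W * Vp)).differentiableAt.comp (0 : ℝ) hinv)
  have hq := (hasDerivAt_pow 2 (0 : ℝ)).smul hg.hasDerivAt
  simp only [orthographicCorrection_smul]
  exact ((hlin.const_add X).add hq).congr_deriv (by simp)

/-- Along a rank `r` curve the corner block equals `D B⁻¹ C` near `0`. Both `C` and `D` vanish at
`0`, so the product rule gives derivative zero. Conversely, the orthographic curve through `X`
realizes every `Z` with vanishing corner as a velocity. -/
lemma mem_tangentSpace_iff (h : IsFrame U Up V Vp) (hX : X = U * M * Vᵀ) (hM : IsUnit M)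
    {Z : Matrix (Fin p₁) (Fin p₂) ℝ} : Z ∈ tangentSpace r X ↔ Upᵀ * Z * Vp = 0 := by
  constructor
  · intro hZ
    have hle : tangentSpace r X ≤ LinearMap.ker (mulMulCLM Upᵀ Vp).toLinearMap := by
      refine Submodule.span_le.2 ?_
      rintro Z ⟨ε, γ, hε, -, hrank, h0, hγ⟩
      have hB : HasDerivAt (fun s => Uᵀ * γ s * V) (Uᵀ * Z * V) 0 :=
        (mulMulCLM Uᵀ V).hasFDerivAt.comp_hasDerivAt (0 : ℝ) hγ
      have hC : HasDerivAt (fun s => Uᵀ * γ s * Vp) (Uᵀ * Z * Vp) 0 :=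
        (mulMulCLM Uᵀ Vp).hasFDerivAt.comp_hasDerivAt (0 : ℝ) hγ
      have hD : HasDerivAt (fun s => Upᵀ * γ s * V) (Upᵀ * Z * V) 0 :=
        (mulMulCLM Upᵀ V).hasFDerivAt.comp_hasDerivAt (0 : ℝ) hγ
      have hE : HasDerivAt (fun s => Upᵀ * γ s * Vp) (Upᵀ * Z * Vp) 0 :=
        (mulMulCLM Upᵀ Vp).hasFDerivAt.comp_hasDerivAt (0 : ℝ) hγ
      have hunit : IsUnit (Uᵀ * γ 0 * V) := by rwa [h0, h.middle_block hX]
      have hinv := ((contDiffAt_matrix_inv hunit).differentiableAt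
        (by simp)).hasFDerivAt.comp_hasDerivAt (0 : ℝ) hB
      have hDB := (isBoundedBilinearMap_matrix_mul.hasFDerivAt _).comp_hasDerivAt (0 : ℝ)
        (hD.prodMk hinv)
      have hDBC := (isBoundedBilinearMap_matrix_mul.hasFDerivAt _).comp_hasDerivAt (0 : ℝ)
        (hDB.prodMk hC)
      have hev : (fun s => Upᵀ * γ s * Vp) =ᶠ[𝓝 0]
          fun s => Upᵀ * γ s * V * (Uᵀ * γ s * V)⁻¹ * (Uᵀ * γ s * Vp) := by
        filter_upwards [Ioo_mem_nhds (neg_lt_zero.2 hε) hε,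
          hB.continuousAt.preimage_mem_nhds (Units.isOpen.mem_nhds hunit)] with s hs hs'
        have := eq_mul_inv_mul_of_rank (hrank s hs) hs'
        conv_lhs => rw [this]
        simp only [Matrix.mul_assoc]
      have huniq := hE.unique (hDBC.congr_of_eventuallyEq hev)
      have hD0 : ∀ {k : ℕ} (N : Matrix (Fin p₂) (Fin k) ℝ), Upᵀ * (γ 0 * N) = 0 := fun N => by
        rw [← Matrix.mul_assoc, h0, h.left_block_zero hX, Matrix.zero_mul]
      have hC0 : γ 0 * Vp = 0 := by rw [h0, h.right_block_zero hX]
      simpa [IsBoundedBilinearMap.deriv_apply, Matrix.mul_assoc, hD0, hC0] using huniq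
    exact LinearMap.mem_ker.1 (hle hZ)
  · intro hZ
    refine Submodule.subset_span ?_
    have hcont : Continuous fun s : ℝ => s • Z := continuous_id.smul continuous_const
    have hnhds := ((isOpen_setOf_isUnit_block X U V).preimage hcont).mem_nhds
      (x := (0 : ℝ)) (by simpa [h.middle_block hX] using hM)
    obtain ⟨ε, hε, hsub⟩ := Metric.mem_nhds_iff.1 hnhds
    rw [Real.ball_eq_Ioo, zero_sub, zero_add] at hsub
    refine ⟨ε, fun s => X + s • Z + orthographicCorrection U Up V Vp X (s • Z), hε, ?_, ?_, ?_,
      h.hasDerivAt_curve hX hM Z⟩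
    · intro s hs
      have h1 : ContDiffAt ℝ ∞ (fun s : ℝ => s • Z) s := contDiffAt_id.smul contDiffAt_const
      exact ((contDiffAt_const.add h1).add
        ((contDiffAt_orthographicCorrection (hsub hs)).comp s h1)).contDiffWithinAt
    · intro s hs
      have hsZ : Upᵀ * (s • Z) * Vp = 0 := by rw [Matrix.mul_smul, Matrix.smul_mul, hZ, smul_zero]
      beta_reduce
      rw [← h.orthographicRetraction_eq hX hsZ]
      exact h.rank_orthographicRetraction (hsub hs)
    · simp [orthographicCorrection]

lemma isRetractionAt (h : IsFrame U Up V Vp) (hX : X = U * M * Vᵀ) (hM : IsUnit M) :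
    IsRetractionAt r X (orthographicRetraction U Up V Vp X) := by
  have hT : ∀ η ∈ tangentSpace r X, orthographicRetraction U Up V Vp X η =
      X + η + orthographicCorrection U Up V Vp X η := fun η hη =>
    h.orthographicRetraction_eq hX ((h.mem_tangentSpace_iff hX hM).1 hη)
  have hunit : IsUnit (Uᵀ * (X + 0) * V) := by rwa [add_zero, h.middle_block hX]
  refine ⟨?_, ?_, ?_, ?_⟩
  · filter_upwards [((isOpen_setOf_isUnit_block X U V).preimage
      (tangentSpace r X).subtypeL.continuous).mem_nhds (x := 0) hunit] with η hη
    exact h.rank_orthographicRetraction hη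
  · have h1 : (fun η : tangentSpace r X => orthographicRetraction U Up V Vp X η) =
        fun η : tangentSpace r X => X + (tangentSpace r X).subtypeL η +
          orthographicCorrection U Up V Vp X ((tangentSpace r X).subtypeL η) :=
      funext fun η => hT η η.2
    have h2 : ContDiffAt ℝ ∞ (tangentSpace r X).subtypeL 0 :=
      (tangentSpace r X).subtypeL.contDiff.contDiffAt
    rw [h1]
    exact (contDiffAt_const.add h2).add
      (ContDiffAt.comp (0 : tangentSpace r X)
        (contDiffAt_orthographicCorrection (W := (tangentSpace r X).subtypeL 0) hunit) h2)
  · rw [hT 0 (zero_mem _)]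
    simp [orthographicCorrection]
  · intro η hη
    have h1 : (fun s : ℝ => orthographicRetraction U Up V Vp X (s • η)) =
        fun s : ℝ => X + s • η + orthographicCorrection U Up V Vp X (s • η) :=
      funext fun s => hT _ (Submodule.smul_mem _ s hη)
    rw [h1]
    exact h.hasDerivAt_curve hX hM η

end IsFrame

end

end

/-! ### Restricted isometry -/

section RIP

variable {p₁ p₂ n : ℕ} {A : Fin n → Matrix (Fin p₁) (Fin p₂) ℝ}

/-- The infimum satisfies the inequalities because they are closed conditions on `R`. Only
nonemptiness of the set of constants is needed, which a crude Cauchy–Schwarz bound supplies. -/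
lemma ripConst_spec (A : Fin n → Matrix (Fin p₁) (Fin p₂) ℝ) {k : ℕ}
    {Z : Matrix (Fin p₁) (Fin p₂) ℝ} (hZ : Z.rank ≤ k) :
    (1 - ripConst A k) * ‖Z‖ ^ 2 ≤ ‖measurementMap A Z‖ ^ 2 ∧
      ‖measurementMap A Z‖ ^ 2 ≤ (1 + ripConst A k) * ‖Z‖ ^ 2 := by
  have hne : {R : ℝ | ∀ Z : Matrix (Fin p₁) (Fin p₂) ℝ, Z.rank ≤ k →
    (1 - R) * ‖Z‖ ^ 2 ≤ ‖measurementMap A Z‖ ^ 2 ∧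
      ‖measurementMap A Z‖ ^ 2 ≤ (1 + R) * ‖Z‖ ^ 2}.Nonempty := by
    refine ⟨∑ i, ‖A i‖ ^ 2 + 1, fun Z _ => ?_⟩
    have h1 : ‖measurementMap A Z‖ ^ 2 ≤ (∑ i, ‖A i‖ ^ 2) * ‖Z‖ ^ 2 := by
      rw [EuclideanSpace.norm_sq_eq, Finset.sum_mul]
      refine Finset.sum_le_sum fun i _ => ?_
      rw [← mul_pow]
      exact pow_le_pow_left₀ (norm_nonneg _) (norm_inner_le_norm (𝕜 := ℝ) (A i) Z) 2
    have h2 : 0 ≤ ∑ i, ‖A i‖ ^ 2 := Finset.sum_nonneg fun i _ => sq_nonneg _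
    constructor <;> nlinarith [sq_nonneg ‖Z‖, sq_nonneg ‖measurementMap A Z‖,
      mul_nonneg h2 (sq_nonneg ‖Z‖)]
  constructor <;> refine le_of_forall_pos_le_add fun ε hε => ?_ <;>
  · obtain ⟨R, hR, hlt⟩ := exists_lt_of_csInf_lt hne
      (lt_add_of_pos_right _ (div_pos hε (by positivity : 0 < ‖Z‖ ^ 2 + 1)))
    have h1 := hR Z hZ
    change R < ripConst A k + _ at hlt
    have h2 : ε / (‖Z‖ ^ 2 + 1) * ‖Z‖ ^ 2 ≤ ε := by
      rw [div_mul_eq_mul_div, div_le_iff₀ (by positivity)]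
      nlinarith
    nlinarith [mul_le_mul_of_nonneg_right hlt.le (sq_nonneg ‖Z‖)]

lemma ripConst_nonneg (A : Fin n → Matrix (Fin p₁) (Fin p₂) ℝ) {k : ℕ}
    {Z : Matrix (Fin p₁) (Fin p₂) ℝ} (hZ : Z.rank ≤ k) (h0 : Z ≠ 0) : 0 ≤ ripConst A k := by
  obtain ⟨h1, h2⟩ := ripConst_spec A hZ
  have := norm_pos_iff.2 h0
  by_contra! h
  nlinarith [sq_pos_of_pos this]

/-- Polarization: `‖W‖ Z + ‖Z‖ W` and `‖W‖ Z - ‖Z‖ W` have the same norm by orthogonality, so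
subtracting the lower RIP bound for the second from the upper one for the first isolates the cross
term. -/
lemma inner_measurementMap_le (A : Fin n → Matrix (Fin p₁) (Fin p₂) ℝ) {k : ℕ}
    {Z W : Matrix (Fin p₁) (Fin p₂) ℝ} (hrank : ∀ a b : ℝ, (a • Z + b • W).rank ≤ k)
    (horth : inner ℝ Z W = 0) :
    inner ℝ (measurementMap A Z) (measurementMap A W) ≤ ripConst A k * (‖Z‖ * ‖W‖) := by
  rcases eq_or_ne Z 0 with rfl | hZ
  · simp
  rcases eq_or_ne W 0 with rfl | hW
  · simp
  have hc : 0 < ‖Z‖ * ‖W‖ := mul_pos (norm_pos_iff.2 hZ) (norm_pos_iff.2 hW)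
  have h1 := (ripConst_spec A (hrank ‖W‖ ‖Z‖)).2
  have h2 := (ripConst_spec A (hrank ‖W‖ (-‖Z‖))).1
  simp only [map_add, map_smul, norm_add_sq_real, norm_smul, inner_smul_left, inner_smul_right,
    horth, neg_smul, inner_neg_right, norm_neg, norm_norm, map_neg, conj_trivial] at h1 h2
  nlinarith

end RIP

lemma matrix_rank_add_le {m n : Type*} [Fintype m] [Fintype n] (X Y : Matrix m n ℝ) :
    (X + Y).rank ≤ X.rank + Y.rank := by
  have h : (X + Y).mulVecLin.range ≤ X.mulVecLin.range ⊔ Y.mulVecLin.range := by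
    rintro _ ⟨v, rfl⟩
    rw [Matrix.mulVecLin_add]
    exact Submodule.add_mem_sup ⟨v, rfl⟩ ⟨v, rfl⟩
  exact (Submodule.finrank_mono h).trans (Submodule.finrank_add_le_finrank_add_finrank _ _)

/-! ### The least squares problem -/

section LeastSquares

variable {p₁ p₂ n r : ℕ}
    {U : Matrix (Fin p₁) (Fin r) ℝ} {Up : Matrix (Fin p₁) (Fin (p₁ - r)) ℝ}
    {V : Matrix (Fin p₂) (Fin r) ℝ} {Vp : Matrix (Fin p₂) (Fin (p₂ - r)) ℝ}

lemma sketch_eq_measurementMap (A : Fin n → Matrix (Fin p₁) (Fin p₂) ℝ) {a b : ℕ}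
    (L : Matrix (Fin p₁) (Fin a) ℝ) (R : Matrix (Fin p₂) (Fin b) ℝ) (M : Matrix (Fin a) (Fin b) ℝ) :
    sketch A L R M = measurementMap A (L * M * Rᵀ) := by
  ext i
  change inner ℝ M (Lᵀ * A i * R) = inner ℝ (A i) (L * M * Rᵀ)
  rw [real_inner_comm _ (A i), frobenius_inner_mul_right, frobenius_inner_mul_left,
    Matrix.transpose_transpose, Matrix.mul_assoc]

lemma sketchedLoss_eq (A : Fin n → Matrix (Fin p₁) (Fin p₂) ℝ) (y : EuclideanSpace ℝ (Fin n))
    (B : Matrix (Fin r) (Fin r) ℝ) (D₁ : Matrix (Fin (p₁ - r)) (Fin r) ℝ)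
    (D₂ : Matrix (Fin (p₂ - r)) (Fin r) ℝ) :
    sketchedLoss A y U Up V Vp B D₁ D₂ =
      ‖y - measurementMap A (assemble U Up V Vp B D₂ᵀ D₁ 0)‖ ^ 2 := by
  rw [sketchedLoss, assemble_eq, sketch_eq_measurementMap, sketch_eq_measurementMap,
    sketch_eq_measurementMap, Matrix.mul_zero, Matrix.zero_mul, add_zero, map_add, map_add]
  congr 2
  abel

lemma inner_eq_zero_of_forall_norm_sub_le {E : Type*} [NormedAddCommGroup E]
    [InnerProductSpace ℝ E] {u v : E} (h : ∀ s : ℝ, ‖u‖ ^ 2 ≤ ‖u - s • v‖ ^ 2) :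
    inner ℝ u v = 0 := by
  rcases eq_or_ne v 0 with rfl | hv
  · simp
  have hv' : 0 < ‖v‖ ^ 2 := sq_pos_of_pos (norm_pos_iff.2 hv)
  -- The minimizer in `s` of the right-hand side.
  have h1 := h (inner ℝ u v / ‖v‖ ^ 2)
  rw [norm_sub_sq_real, inner_smul_right, norm_smul, mul_pow, Real.norm_eq_abs, sq_abs] at h1
  have h2 : (inner ℝ u v / ‖v‖ ^ 2) ^ 2 * ‖v‖ ^ 2 = inner ℝ u v / ‖v‖ ^ 2 * inner ℝ u v := by
    field_simp
  have h3 : inner ℝ u v / ‖v‖ ^ 2 * inner ℝ u v = inner ℝ u v ^ 2 / ‖v‖ ^ 2 := by ring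
  have h4 : inner ℝ u v ^ 2 / ‖v‖ ^ 2 ≤ 0 := by linarith
  rw [div_le_iff₀ hv', zero_mul] at h4
  exact pow_eq_zero_iff two_ne_zero |>.1 (le_antisymm h4 (sq_nonneg _))

/-- The normal equations of the sketched least squares problem. -/
lemma IsFrame.normal_equations (h : IsFrame U Up V Vp) {A : Fin n → Matrix (Fin p₁) (Fin p₂) ℝ}
    {y : EuclideanSpace ℝ (Fin n)} {B : Matrix (Fin r) (Fin r) ℝ}
    {D₁ : Matrix (Fin (p₁ - r)) (Fin r) ℝ} {D₂ : Matrix (Fin (p₂ - r)) (Fin r) ℝ}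
    (hmin : ∀ B' D₁' D₂', sketchedLoss A y U Up V Vp B D₁ D₂ ≤
      sketchedLoss A y U Up V Vp B' D₁' D₂')
    {Z : Matrix (Fin p₁) (Fin p₂) ℝ} (hZ : Upᵀ * Z * Vp = 0) :
    inner ℝ (y - measurementMap A (assemble U Up V Vp B D₂ᵀ D₁ 0)) (measurementMap A Z) = 0 := by
  refine inner_eq_zero_of_forall_norm_sub_le fun s => ?_
  -- Moving the three blocks along those of `Z` moves the assembled matrix by exactly `s • Z`, since
  -- the corner of `Z` is zero.
  have h1 := hmin (B + s • (Uᵀ * Z * V)) (D₁ + s • (Upᵀ * Z * V)) (D₂ + s • (Uᵀ * Z * Vp)ᵀ)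
  rw [sketchedLoss_eq, sketchedLoss_eq] at h1
  have h2 : assemble U Up V Vp (B + s • (Uᵀ * Z * V)) (D₂ + s • (Uᵀ * Z * Vp)ᵀ)ᵀ
      (D₁ + s • (Upᵀ * Z * V)) 0 = assemble U Up V Vp B D₂ᵀ D₁ 0 + s • Z := by
    conv_rhs => rw [← h.assemble_self Z, hZ]
    simp only [assemble_eq, Matrix.transpose_add, Matrix.transpose_smul,
      Matrix.transpose_transpose, Matrix.mul_add, Matrix.add_mul, Matrix.mul_smul, Matrix.smul_mul,
      smul_add, Matrix.mul_zero, Matrix.zero_mul, add_zero]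
    abel
  rwa [h2, map_add, map_smul, ← sub_sub] at h1

end LeastSquares

/-! ### The Riemannian gradient -/

section Gradient

variable {p₁ p₂ n : ℕ}

lemma fderiv_objective (A : Fin n → Matrix (Fin p₁) (Fin p₂) ℝ) (y : EuclideanSpace ℝ (Fin n))
    (X Z : Matrix (Fin p₁) (Fin p₂) ℝ) :
    fderiv ℝ (objective A y) X Z = inner ℝ (measurementMap A X - y) (measurementMap A Z) := by
  set L := LinearMap.toContinuousLinearMap (measurementMap A)
  have h1 : HasFDerivAt (fun X => y - L X) (-L) X := L.hasFDerivAt.const_sub y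
  have h2 := (h1.norm_sq).const_mul (1 / 2 : ℝ)
  have h3 : HasFDerivAt (objective A y) _ X := h2
  rw [h3.fderiv]
  change (1 / 2 : ℝ) * ((2 : ℕ) • inner ℝ (y - measurementMap A X) (-(measurementMap A Z))) = _
  rw [inner_neg_right, ← inner_neg_left, neg_sub, nsmul_eq_mul]
  push_cast
  ring

lemma inner_riemannianGrad (r : ℕ) (f : Matrix (Fin p₁) (Fin p₂) ℝ → ℝ)
    (X : Matrix (Fin p₁) (Fin p₂) ℝ) {Z : Matrix (Fin p₁) (Fin p₂) ℝ}
    (hZ : Z ∈ tangentSpace r X) : inner ℝ (riemannianGrad r f X) Z = fderiv ℝ f X Z :=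
  InnerProductSpace.toDual_symm_apply (𝕜 := ℝ) (E := tangentSpace r X) (x := ⟨Z, hZ⟩)

lemma starProjection_eq_neg_riemannianGrad {r : ℕ} {A : Fin n → Matrix (Fin p₁) (Fin p₂) ℝ}
    {y : EuclideanSpace ℝ (Fin n)} {X η : Matrix (Fin p₁) (Fin p₂) ℝ}
    (h : ∀ Z ∈ tangentSpace r X,
      inner ℝ (y - measurementMap A (X + η)) (measurementMap A Z) = 0) :
    (tangentSpace r X).starProjection
        (LinearMap.adjoint (measurementMap A) (measurementMap A η)) =
      -riemannianGrad r (objective A y) X := by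
  set T := tangentSpace r X
  have hmem : T.starProjection (LinearMap.adjoint (measurementMap A) (measurementMap A η)) +
      riemannianGrad r (objective A y) X ∈ T :=
    add_mem (Submodule.starProjection_apply_mem _ _) (SetLike.coe_mem _)
  -- The sum of the two sides is tangent, so it is enough to test it against itself.
  rw [eq_neg_iff_add_eq_zero, ← inner_self_eq_zero (𝕜 := ℝ)]
  have h1 := h _ hmem
  rw [inner_add_left, inner_riemannianGrad r _ X hmem, fderiv_objective,
    Submodule.inner_starProjection_left_eq_right, Submodule.starProjection_eq_self_iff.2 hmem,
    LinearMap.adjoint_inner_left, ← inner_add_left]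
  rw [← neg_sub, inner_neg_left, map_add, neg_eq_zero] at h1
  rw [← h1]
  congr 1
  abel

end Gradient

/-! ### The error of one iteration -/

section Error

variable {p₁ p₂ r : ℕ}
    {U : Matrix (Fin p₁) (Fin r) ℝ} {Up : Matrix (Fin p₁) (Fin (p₁ - r)) ℝ}
    {V : Matrix (Fin p₂) (Fin r) ℝ} {Vp : Matrix (Fin p₂) (Fin (p₂ - r)) ℝ}
    {X Xbar : Matrix (Fin p₁) (Fin p₂) ℝ} {M : Matrix (Fin r) (Fin r) ℝ}
    {Ub : Matrix (Fin p₁) (Fin r) ℝ} {sb : Fin r → ℝ} {Vb : Matrix (Fin p₂) (Fin r) ℝ} {σ e : ℝ}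

lemma IsSVD.mul_right (h : IsSVD Xbar Ub sb Vb) : Xbar * Vb = Ub * Matrix.diagonal sb := by
  conv_lhs => rw [h.eq]
  rw [Matrix.mul_assoc, h.orth_right, Matrix.mul_one]

lemma IsSVD.mul_left (h : IsSVD Xbar Ub sb Vb) : Ubᵀ * Xbar = Matrix.diagonal sb * Vbᵀ := by
  conv_lhs => rw [h.eq]
  rw [Matrix.mul_assoc, ← Matrix.mul_assoc, h.orth_left, Matrix.one_mul]

/-- A lower bound for the smallest singular value under perturbation. -/
lemma IsSVD.isBoundedBelow_of_norm_sub_le (h : IsSVD Xbar Ub sb Vb) (hσ : 0 ≤ σ)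
    (hs : ∀ i, σ ≤ sb i) (hU : Uᵀ * U = 1) (hV : Vᵀ * V = 1) (hX : X = U * M * Vᵀ)
    (he : ‖X - Xbar‖ ≤ e) (heσ : e < σ) : IsBoundedBelow (σ - e) M := by
  -- Compressing `X` to the singular vectors of `Xbar` gives the diagonal of singular values plus an
  -- error of norm at most `e`; the contractions `Ubᵀ U` and `Vᵀ Vb` are then stripped off.
  have h1 : IsBoundedBelow (σ - e) (Ubᵀ * U * M * (Vᵀ * Vb)) := by
    have h2 : Ubᵀ * U * M * (Vᵀ * Vb) = Matrix.diagonal sb + Ubᵀ * (X - Xbar) * Vb := by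
      rw [Matrix.mul_sub, Matrix.sub_mul, Matrix.mul_assoc Ubᵀ Xbar, h.mul_right,
        ← Matrix.mul_assoc Ubᵀ Ub, h.orth_left, Matrix.one_mul, hX]
      simp only [Matrix.mul_assoc, add_sub_cancel]
    rw [h2]
    exact (IsBoundedBelow.diagonal hσ hs).add
      ((frobenius_norm_mul_le_of_orthonormal h.orth_right _).trans
        ((frobenius_norm_transpose_mul_le h.orth_left _).trans he))
  refine IsBoundedBelow.of_mul_mul (sub_pos.2 heσ) h1 (fun N => ?_) (fun N => ?_) (fun N => ?_)
    (fun N => ?_)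
  · rw [Matrix.mul_assoc]
    exact (frobenius_norm_transpose_mul_le h.orth_left _).trans
      (frobenius_norm_mul_of_orthonormal hU _).le
  · rw [← Matrix.mul_assoc]
    exact (frobenius_norm_mul_le_of_orthonormal hU _).trans
      (frobenius_norm_mul_transpose_of_orthonormal h.orth_left _).le
  · rw [Matrix.mul_assoc]
    exact (frobenius_norm_transpose_mul_le hV _).trans
      (frobenius_norm_mul_of_orthonormal h.orth_right _).le
  · rw [← Matrix.mul_assoc]
    exact (frobenius_norm_mul_le_of_orthonormal h.orth_right _).trans
      (frobenius_norm_mul_transpose_of_orthonormal hV _).le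

namespace IsFrame

lemma norm_block_le (h : IsFrame U Up V Vp) (W : Matrix (Fin p₁) (Fin p₂) ℝ) :
    ‖Uᵀ * W * V‖ ≤ ‖W‖ ∧ ‖Uᵀ * W * Vp‖ ≤ ‖W‖ ∧ ‖Upᵀ * W * V‖ ≤ ‖W‖ ∧ ‖Upᵀ * W * Vp‖ ≤ ‖W‖ :=
  ⟨(frobenius_norm_mul_le_of_orthonormal h.orth_right _).trans
      (frobenius_norm_transpose_mul_le h.orth_left _),
    (frobenius_norm_mul_le_of_orthonormal h.compl_right.orth _).trans
      (frobenius_norm_transpose_mul_le h.orth_left _),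
    (frobenius_norm_mul_le_of_orthonormal h.orth_right _).trans
      (frobenius_norm_transpose_mul_le h.compl_left.orth _),
    (frobenius_norm_mul_le_of_orthonormal h.compl_right.orth _).trans
      (frobenius_norm_transpose_mul_le h.compl_left.orth _)⟩

/-- The part of `Xbar` normal to the tangent space at `X` is of second order. -/
lemma norm_normal_block_le (h : IsFrame U Up V Vp) (hX : X = U * M * Vᵀ)
    (hsvd : IsSVD Xbar Ub sb Vb) (hσ : 0 < σ) (hs : ∀ i, σ ≤ sb i) (he : ‖X - Xbar‖ ≤ e) :
    ‖Upᵀ * Xbar * Vp‖ ≤ e ^ 2 / σ := by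
  have he0 : 0 ≤ e := (norm_nonneg _).trans he
  have hbb := IsBoundedBelow.diagonal hσ.le hs
  have hu := (Matrix.isUnit_iff_isUnit_det _).1 (hbb.isUnit hσ)
  -- Inserting the SVD as `Xbar Vb Σ⁻¹ Ubᵀ Xbar` gives two factors which both kill `X`. Each is
  -- therefore first order in `Xbar - X`.
  have h1 : Upᵀ * Xbar * Vp =
      (Upᵀ * (Xbar - X) * Vb) * ((Matrix.diagonal sb)⁻¹ * (Ubᵀ * (Xbar - X) * Vp)) := by
    have h2 : Upᵀ * (Xbar - X) * Vb = Upᵀ * Ub * Matrix.diagonal sb := by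
      rw [Matrix.mul_sub, h.left_block_zero hX, sub_zero, Matrix.mul_assoc, hsvd.mul_right,
        Matrix.mul_assoc]
    have h3 : Ubᵀ * (Xbar - X) * Vp = Matrix.diagonal sb * (Vbᵀ * Vp) := by
      rw [Matrix.mul_assoc, Matrix.sub_mul, h.right_block_zero hX, sub_zero, ← Matrix.mul_assoc,
        hsvd.mul_left, Matrix.mul_assoc]
    rw [h2, h3, Matrix.nonsing_inv_mul_cancel_left _ _ hu]
    conv_lhs => rw [hsvd.eq]
    simp only [Matrix.mul_assoc]
  have he' : ‖Xbar - X‖ ≤ e := by rwa [norm_sub_rev]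
  rw [h1]
  refine (Matrix.frobenius_norm_mul _ _).trans ?_
  have h4 : ‖Upᵀ * (Xbar - X) * Vb‖ ≤ e :=
    (frobenius_norm_mul_le_of_orthonormal hsvd.orth_right _).trans
      ((frobenius_norm_transpose_mul_le h.compl_left.orth _).trans he')
  have h5 : ‖(Matrix.diagonal sb)⁻¹ * (Ubᵀ * (Xbar - X) * Vp)‖ ≤ e / σ := by
    refine (hbb.norm_inv_mul_le hσ _).trans (div_le_div_of_nonneg_right ?_ hσ.le)
    exact (frobenius_norm_mul_le_of_orthonormal h.compl_right.orth _).trans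
      ((frobenius_norm_transpose_mul_le hsvd.orth_left _).trans he')
  calc _ ≤ e * (e / σ) := mul_le_mul h4 h5 (norm_nonneg _) he0
    _ = e ^ 2 / σ := by ring

/-- A matrix annihilated by `Xbar` on both sides is almost normal to the tangent space at `X`. -/
lemma inner_le_of_annihilated (h : IsFrame U Up V Vp) (hX : X = U * M * Vᵀ) {c : ℝ} (hc : 0 < c)
    (hM : IsBoundedBelow c M) (he : ‖X - Xbar‖ ≤ e) {G E : Matrix (Fin p₁) (Fin p₂) ℝ}
    (hG₁ : Gᵀ * Xbar = 0) (hG₂ : Xbar * Gᵀ = 0) (hE : Upᵀ * E * Vp = 0) :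
    inner ℝ G E ≤ 2 * (e / c * ‖G‖) * ‖E‖ := by
  -- `Gᵀ U M = Gᵀ X V = Gᵀ (X - Xbar) V` is small, and `M` can be divided out.
  have h1 : ‖Uᵀ * G‖ ≤ e / c * ‖G‖ := by
    have h2 := hM.right (Gᵀ * U)
    have h3 : Gᵀ * U * M = Gᵀ * (X - Xbar) * V := by
      rw [Matrix.mul_sub, hG₁, sub_zero, hX]
      simp only [Matrix.mul_assoc, h.orth_right, Matrix.mul_one]
    rw [h3, ← Matrix.frobenius_norm_transpose (Gᵀ * U), Matrix.transpose_mul,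
      Matrix.transpose_transpose] at h2
    have h4 := (frobenius_norm_mul_le_of_orthonormal h.orth_right (Gᵀ * (X - Xbar))).trans
      (Matrix.frobenius_norm_mul _ _)
    rw [Matrix.frobenius_norm_transpose] at h4
    rw [div_mul_eq_mul_div, le_div_iff₀ hc]
    nlinarith [mul_le_mul_of_nonneg_left he (norm_nonneg G)]
  have h1' : ‖G * V‖ ≤ e / c * ‖G‖ := by
    have h2 := hM.left (Vᵀ * Gᵀ)
    have h3 : M * (Vᵀ * Gᵀ) = Uᵀ * ((X - Xbar) * Gᵀ) := by
      rw [Matrix.sub_mul, hG₂, sub_zero, hX]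
      simp only [← Matrix.mul_assoc, h.orth_left, Matrix.one_mul]
    rw [h3, ← Matrix.transpose_mul, Matrix.frobenius_norm_transpose] at h2
    have h4 := (frobenius_norm_transpose_mul_le h.orth_left ((X - Xbar) * Gᵀ)).trans
      (Matrix.frobenius_norm_mul _ _)
    rw [Matrix.frobenius_norm_transpose] at h4
    rw [div_mul_eq_mul_div, le_div_iff₀ hc]
    nlinarith [mul_le_mul_of_nonneg_right he (norm_nonneg G)]
  -- A tangent `E` pairs with `G` only through `Uᵀ G` and `G V`, the two small pieces.
  have hE' : E = U * (Uᵀ * E) + Up * (Upᵀ * E * V) * Vᵀ := by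
    have h5 := h.compl_right.mul_transpose_add h.orth_right
    have h6 := h.compl_left.mul_transpose_add h.orth_left
    calc E = (U * Uᵀ + Up * Upᵀ) * E := by rw [h6, Matrix.one_mul]
      _ = U * (Uᵀ * E) + Up * (Upᵀ * E * (V * Vᵀ + Vp * Vpᵀ)) := by
        rw [h5, Matrix.mul_one, Matrix.add_mul, Matrix.mul_assoc, Matrix.mul_assoc]
      _ = _ := by
        rw [Matrix.mul_add, ← Matrix.mul_assoc _ Vp, hE, Matrix.zero_mul, add_zero,
          ← Matrix.mul_assoc _ V, ← Matrix.mul_assoc Up]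
  have h7 : inner ℝ G E = inner ℝ (Uᵀ * G) (Uᵀ * E) + inner ℝ (Upᵀ * (G * V)) (Upᵀ * E * V) := by
    conv_lhs => rw [hE', inner_add_right]
    rw [frobenius_inner_mul_left Uᵀ, frobenius_inner_mul_left Upᵀ, frobenius_inner_mul_right G V,
      Matrix.transpose_transpose, Matrix.transpose_transpose]
  have h8 : inner ℝ (Uᵀ * G) (Uᵀ * E) ≤ e / c * ‖G‖ * ‖E‖ :=
    (real_inner_le_norm _ _).trans (mul_le_mul h1
      (frobenius_norm_transpose_mul_le h.orth_left _) (norm_nonneg _) ((norm_nonneg _).trans h1))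
  have h9 : inner ℝ (Upᵀ * (G * V)) (Upᵀ * E * V) ≤ e / c * ‖G‖ * ‖E‖ :=
    (real_inner_le_norm _ _).trans (mul_le_mul
      ((frobenius_norm_transpose_mul_le h.compl_left.orth _).trans h1')
      (h.norm_block_le E).2.2.1 (norm_nonneg _) ((norm_nonneg _).trans h1'))
  rw [h7]
  linarith

lemma rank_tangent_le (h : IsFrame U Up V Vp) {E : Matrix (Fin p₁) (Fin p₂) ℝ}
    (hE : Upᵀ * E * Vp = 0) : E.rank ≤ 2 * r := by
  have h1 : E = U * (Uᵀ * E * V * Vᵀ + Uᵀ * E * Vp * Vpᵀ) + Up * (Upᵀ * E * V) * Vᵀ := by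
    conv_lhs => rw [← h.assemble_self E, hE, assemble_eq]
    rw [Matrix.mul_zero, Matrix.zero_mul, add_zero, Matrix.mul_add]
    simp only [Matrix.mul_assoc]
  rw [h1]
  refine (matrix_rank_add_le _ _).trans ?_
  have h2 := rank_mul_le_of_mid U (Uᵀ * E * V * Vᵀ + Uᵀ * E * Vp * Vpᵀ)
  have h3 := rank_mul_le_of_mid (Up * (Upᵀ * E * V)) Vᵀ
  omega

variable {n : ℕ} {A : Fin n → Matrix (Fin p₁) (Fin p₂) ℝ} {y : EuclideanSpace ℝ (Fin n)}

/-- The tangential error of the least squares step. -/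
lemma norm_tangential_error_le (h : IsFrame U Up V Vp) (hX : X = U * M * Vᵀ) (hr : Xbar.rank = r)
    (hsvd : IsSVD Xbar Ub sb Vb) (hσ : 0 < σ) (hs : ∀ i, σ ≤ sb i)
    (hG₁ : (LinearMap.adjoint (measurementMap A) (y - measurementMap A Xbar))ᵀ * Xbar = 0)
    (hG₂ : Xbar * (LinearMap.adjoint (measurementMap A) (y - measurementMap A Xbar))ᵀ = 0)
    (hR2 : ripConst A (2 * r) < 1) (hR3 : 0 ≤ ripConst A (3 * r))
    (he : ‖X - Xbar‖ ≤ e) (he₁ : e ≤ 1 / 4 * σ)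
    (he₂ : 4 * √5 * ripConst A (3 * r) * e ≤ (1 - ripConst A (2 * r)) * σ)
    (hres : ‖LinearMap.adjoint (measurementMap A) (y - measurementMap A Xbar)‖ ≤
      (1 - ripConst A (2 * r)) / (4 * √5) * σ)
    {E : Matrix (Fin p₁) (Fin p₂) ℝ} (hE : Upᵀ * E * Vp = 0)
    (hnormal : inner ℝ (y - measurementMap A (Xbar - Up * (Upᵀ * Xbar * Vp) * Vpᵀ + E))
      (measurementMap A E) = 0) : ‖E‖ ≤ 5 / 12 * e := by
  set G := LinearMap.adjoint (measurementMap A) (y - measurementMap A Xbar) with hG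
  set P := Up * (Upᵀ * Xbar * Vp) * Vpᵀ with hP
  set a := 1 - ripConst A (2 * r) with ha
  set R := ripConst A (3 * r) with hR
  have he0 : 0 ≤ e := (norm_nonneg _).trans he
  have ha0 : 0 < a := sub_pos.2 hR2
  have h1 : ‖measurementMap A E‖ ^ 2 =
      inner ℝ (measurementMap A E) (measurementMap A P) + inner ℝ G E := by
    have h2 : y - measurementMap A (Xbar - P + E) =
        (y - measurementMap A Xbar) + measurementMap A P - measurementMap A E := by
      rw [map_add, map_sub]
      abel
    rw [h2, inner_sub_left, inner_add_left, real_inner_self_eq_norm_sq,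
      ← LinearMap.adjoint_inner_left, ← hG, real_inner_comm (measurementMap A E)] at hnormal
    linarith
  have h2 := (ripConst_spec A (h.rank_tangent_le hE)).1
  have hPnorm : ‖P‖ ≤ e ^ 2 / σ := by
    rw [hP, frobenius_norm_mul_transpose_of_orthonormal h.compl_right.orth,
      frobenius_norm_mul_of_orthonormal h.compl_left.orth]
    exact h.norm_normal_block_le hX hsvd hσ hs he
  have hPE : inner ℝ E P = 0 := by
    rw [hP, real_inner_comm, frobenius_inner_mul_right, frobenius_inner_mul_left,
      Matrix.transpose_transpose, ← Matrix.mul_assoc, hE, inner_zero_right]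
  have hPr : P.rank ≤ r := by
    rw [hP]
    exact (Matrix.rank_mul_le_left _ _).trans ((Matrix.rank_mul_le_right _ _).trans
      ((Matrix.rank_mul_le_left _ _).trans ((Matrix.rank_mul_le_right _ _).trans hr.le)))
  -- `E` has rank at most `2r` and `P` at most `r`, which is where `R_{3r}` enters.
  have h3 : inner ℝ (measurementMap A E) (measurementMap A P) ≤ R * (‖E‖ * ‖P‖) := by
    refine inner_measurementMap_le A (fun u v => (matrix_rank_add_le _ _).trans ?_) hPE
    have h4 : (u • E).rank ≤ 2 * r := h.rank_tangent_le (by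
      rw [Matrix.mul_smul, Matrix.smul_mul, hE, smul_zero])
    have h5 : (v • P).rank ≤ r := by
      rw [← Matrix.mul_one P, ← Matrix.mul_smul]
      exact (Matrix.rank_mul_le_left _ _).trans hPr
    omega
  have hM := (hsvd.isBoundedBelow_of_norm_sub_le hσ.le hs h.orth_left h.orth_right hX he
    (by linarith)).mono (show 3 / 4 * σ ≤ σ - e by linarith)
  have h4 := h.inner_le_of_annihilated hX (by positivity) hM he hG₁ hG₂ hE
  -- A rational bound sharp enough for the end: `4 · 2.2 = 8.8` and `(11/3) / 8.8 = 5/12`.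
  have hq : (2.2 : ℝ) ≤ √5 := Real.le_sqrt_of_sq_le (by norm_num)
  have hres' : 4 * √5 * ‖G‖ ≤ a * σ := by
    rw [div_mul_eq_mul_div, le_div_iff₀ (by positivity)] at hres
    linarith
  have h5 : a * ‖E‖ ^ 2 ≤ R * (‖E‖ * (e ^ 2 / σ)) + 2 * (e / (3 / 4 * σ) * ‖G‖) * ‖E‖ := by
    have := mul_le_mul_of_nonneg_left (mul_le_mul_of_nonneg_left hPnorm (norm_nonneg E)) hR3
    linarith
  rcases (norm_nonneg E).eq_or_lt with h0 | h0
  · rw [← h0]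
    positivity
  have h6 : a * ‖E‖ ≤ R * (e ^ 2 / σ) + 2 * (e / (3 / 4 * σ) * ‖G‖) := by
    refine le_of_mul_le_mul_right ?_ h0
    linarith
  -- The curvature term contributes `1` and the residual `8/3 = 2 / (3/4)`.
  have h7 : 4 * √5 * (a * ‖E‖) ≤ 11 / 3 * (a * e) := by
    have h8 : 4 * √5 * (R * (e ^ 2 / σ)) ≤ a * e := by
      calc 4 * √5 * (R * (e ^ 2 / σ)) = (4 * √5 * R * e) * e / σ := by ring
        _ ≤ (a * σ) * e / σ := by gcongr
        _ = a * e := by field_simp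
    have h9 : 4 * √5 * (2 * (e / (3 / 4 * σ) * ‖G‖)) ≤ 8 / 3 * (a * e) := by
      calc 4 * √5 * (2 * (e / (3 / 4 * σ) * ‖G‖)) = 8 / 3 * (4 * √5 * ‖G‖) * e / σ := by
            field_simp
            ring
        _ ≤ 8 / 3 * (a * σ) * e / σ := by gcongr
        _ = 8 / 3 * (a * e) := by field_simp
    have h10 := mul_le_mul_of_nonneg_left h6 (by positivity : 0 ≤ 4 * √5)
    linarith
  have h8 : 8.8 * (a * ‖E‖) ≤ 11 / 3 * (a * e) :=
    (mul_le_mul_of_nonneg_right (by linarith) (by positivity)).trans h7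
  refine le_of_mul_le_mul_left ?_ ha0
  linarith

/-- One iteration does not increase the error, and its middle block is invertible. -/
lemma step (h : IsFrame U Up V Vp) (hX : X = U * M * Vᵀ) (hr : Xbar.rank = r)
    (hsvd : IsSVD Xbar Ub sb Vb) (hσ : 0 < σ) (hs : ∀ i, σ ≤ sb i)
    (he : ‖X - Xbar‖ ≤ e) (he₁ : e ≤ 1 / 4 * σ)
    {B : Matrix (Fin r) (Fin r) ℝ} {C : Matrix (Fin r) (Fin (p₂ - r)) ℝ}
    {D : Matrix (Fin (p₁ - r)) (Fin r) ℝ}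
    (hE : ‖assemble U Up V Vp (B - Uᵀ * Xbar * V) (C - Uᵀ * Xbar * Vp) (D - Upᵀ * Xbar * V) 0‖ ≤
      5 / 12 * e) :
    IsUnit B ∧ ‖assemble U Up V Vp B C D (D * B⁻¹ * C) - Xbar‖ ≤ e := by
  have he0 : 0 ≤ e := (norm_nonneg _).trans he
  set Bb := Uᵀ * Xbar * V with hBb
  set Cb := Uᵀ * Xbar * Vp with hCb
  set Db := Upᵀ * Xbar * V with hDb
  set E := assemble U Up V Vp (B - Bb) (C - Cb) (D - Db) 0 with hEdef
  have hsq := h.norm_sq_eq E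
  obtain ⟨e1, e2, e3, e4⟩ := h.blocks_assemble (B - Bb) (C - Cb) (D - Db) 0
  rw [e1, e2, e3, e4, norm_zero] at hsq
  have hM := hsvd.isBoundedBelow_of_norm_sub_le hσ.le hs h.orth_left h.orth_right hX he
    (by linarith)
  have hblk := h.norm_block_le (Xbar - X)
  have he' : ‖Xbar - X‖ ≤ e := by rwa [norm_sub_rev]
  have hBbb : IsBoundedBelow (1 / 2 * σ) Bb := by
    have h1 := hM.add (Δ := Uᵀ * (Xbar - X) * V) (hblk.1.trans he')
    rw [Matrix.mul_sub, Matrix.sub_mul, h.middle_block hX, add_sub_cancel] at h1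
    exact h1.mono (by linarith)
  have hCbn : ‖Cb‖ ≤ 1 / 4 * σ := by
    have h1 := hblk.2.1
    rw [Matrix.mul_assoc, Matrix.sub_mul, h.right_block_zero hX, sub_zero, ← Matrix.mul_assoc] at h1
    linarith
  have hDbn : ‖Db‖ ≤ e := by
    have h1 := hblk.2.2.1
    rw [Matrix.mul_sub, h.left_block_zero hX, sub_zero] at h1
    linarith
  have hb := norm_nonneg (B - Bb)
  have hc := norm_nonneg (C - Cb)
  have hd := norm_nonneg (D - Db)
  have hbE : ‖B - Bb‖ ≤ 5 / 48 * σ := by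
    have : ‖B - Bb‖ ≤ ‖E‖ := abs_le_of_sq_le_sq' (by nlinarith) (norm_nonneg E) |>.2
    linarith
  have hdE : ‖D - Db‖ ≤ 5 / 12 * e := by
    have : ‖D - Db‖ ≤ ‖E‖ := abs_le_of_sq_le_sq' (by nlinarith) (norm_nonneg E) |>.2
    linarith
  -- `19/48 = 1/2 - 5/48`, from the bounds for `Bb` and for `B - Bb`.
  have hBB : IsBoundedBelow (19 / 48 * σ) B := by
    have h1 := hBbb.add hbE
    rw [add_sub_cancel] at h1
    exact h1.mono (by linarith)
  have hBu : IsUnit B := hBB.isUnit (by positivity)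
  have hBbu : IsUnit Bb := hBbb.isUnit (by positivity)
  refine ⟨hBu, ?_⟩
  have hBu' := (Matrix.isUnit_iff_isUnit_det _).1 hBu
  have hBbu' := (Matrix.isUnit_iff_isUnit_det _).1 hBbu
  have hDn : ‖D‖ ≤ 17 / 48 * σ := by
    have h1 := norm_add_le (D - Db) Db
    rw [sub_add_cancel] at h1
    linarith
  -- `Xbar` has rank `r` as well, so its corner has the same form as that of the new iterate and the
  -- two can be compared.
  have hFb : Upᵀ * Xbar * Vp = Db * Bb⁻¹ * Cb := by
    conv_lhs => rw [eq_mul_inv_mul_of_rank hr hBbu]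
    simp only [hDb, hCb, hBb, Matrix.mul_assoc]
  have hT : ‖Bb⁻¹ * Cb‖ ≤ 1 / 2 := by
    refine (hBbb.norm_inv_mul_le (by positivity) _).trans ?_
    rw [div_le_iff₀ (by positivity)]
    linarith
  -- The quotient is `(17/48) / (19/48) = 17/19`.
  have hS : ‖D * B⁻¹‖ ≤ 9 / 10 := by
    refine (hBB.norm_mul_inv_le (by positivity) _).trans ?_
    rw [div_le_iff₀ (by positivity)]
    linarith
  have hdiff : D * B⁻¹ * C - Db * Bb⁻¹ * Cb = D * B⁻¹ * (C - Cb) + (D - Db) * (Bb⁻¹ * Cb) -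
      D * B⁻¹ * ((B - Bb) * (Bb⁻¹ * Cb)) := by
    have h1 : D * B⁻¹ * ((B - Bb) * (Bb⁻¹ * Cb)) = D * (Bb⁻¹ * Cb) - D * B⁻¹ * Cb := by
      rw [Matrix.sub_mul, Matrix.mul_nonsing_inv_cancel_left _ _ hBbu', Matrix.mul_sub,
        ← Matrix.mul_assoc (D * B⁻¹) B, Matrix.nonsing_inv_mul_cancel_right _ _ hBu']
    rw [h1, Matrix.mul_sub, Matrix.sub_mul, Matrix.mul_assoc Db]
    abel
  have hΔ : ‖D * B⁻¹ * C - Db * Bb⁻¹ * Cb‖ ≤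
      9 / 10 * ‖C - Cb‖ + 1 / 2 * ‖D - Db‖ + 9 / 20 * ‖B - Bb‖ := by
    rw [hdiff]
    refine (norm_sub_le _ _).trans (add_le_add ((norm_add_le _ _).trans (add_le_add ?_ ?_)) ?_)
    · exact (Matrix.frobenius_norm_mul _ _).trans (mul_le_mul_of_nonneg_right hS hc)
    · refine (Matrix.frobenius_norm_mul _ _).trans ?_
      rw [mul_comm]
      exact mul_le_mul_of_nonneg_right hT hd
    · have h1 := (Matrix.frobenius_norm_mul (B - Bb) (Bb⁻¹ * Cb)).trans
        (mul_le_mul_of_nonneg_left hT hb)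
      refine ((Matrix.frobenius_norm_mul _ _).trans
        (mul_le_mul hS h1 (norm_nonneg _) (by norm_num))).trans (le_of_eq (by ring))
  -- Cauchy–Schwarz over the three blocks of `E`: `(9/10)² + (1/2)² + (9/20)² = 1.2625 ≤ (7/5)²`.
  -- The constant `7/5` is the largest allowed by `(1 + 7/5) · 5/12 = 1`.
  have hΔE : ‖D * B⁻¹ * C - Db * Bb⁻¹ * Cb‖ ≤ 7 / 5 * ‖E‖ := by
    refine hΔ.trans (abs_le_of_sq_le_sq' ?_ (by positivity)).2
    nlinarith [sq_nonneg (1 / 2 * ‖C - Cb‖ - 9 / 10 * ‖D - Db‖),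
      sq_nonneg (9 / 20 * ‖C - Cb‖ - 9 / 10 * ‖B - Bb‖),
      sq_nonneg (9 / 20 * ‖D - Db‖ - 1 / 2 * ‖B - Bb‖)]
  have hfin : assemble U Up V Vp B C D (D * B⁻¹ * C) - Xbar =
      E + Up * (D * B⁻¹ * C - Db * Bb⁻¹ * Cb) * Vpᵀ := by
    conv_lhs => rw [← h.assemble_self Xbar, hFb]
    rw [hEdef]
    simp only [assemble_eq, Matrix.mul_sub, Matrix.sub_mul, Matrix.mul_zero, Matrix.zero_mul,
      ← hBb, ← hCb, ← hDb]
    abel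
  rw [hfin]
  refine (norm_add_le _ _).trans ?_
  rw [frobenius_norm_mul_transpose_of_orthonormal h.compl_right.orth,
    frobenius_norm_mul_of_orthonormal h.compl_left.orth]
  linarith

end IsFrame

end Error

/-! ### The iteration -/

lemma IsMoorePenrose.eq_inv {r : ℕ} {B P : Matrix (Fin r) (Fin r) ℝ} (h : IsMoorePenrose B P)
    (hB : IsUnit B) : P = B⁻¹ := by
  have hB' := (Matrix.isUnit_iff_isUnit_det _).1 hB
  have h1 := congr_arg (fun N => B⁻¹ * N * B⁻¹) h.mul_mul_self
  rw [Matrix.mul_assoc B, Matrix.nonsing_inv_mul_cancel_left _ _ hB',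
    Matrix.mul_nonsing_inv_cancel_right _ _ hB', Matrix.nonsing_inv_mul _ hB',
    Matrix.one_mul] at h1
  exact h1

namespace RISRORun

variable {p₁ p₂ n r : ℕ} {A : Fin n → Matrix (Fin p₁) (Fin p₂) ℝ}
    {y : EuclideanSpace ℝ (Fin n)} (run : RISRORun A y r)

lemma isFrame (t : ℕ) : IsFrame (run.U t) (run.Up t) (run.V t) (run.Vp t) where
  orth_left := by
    cases t with
    | zero => obtain ⟨s, hs⟩ := run.init; exact hs.orth_left
    | succ t => exact (run.qr_left t).1
  orth_right := by
    cases t with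
    | zero => obtain ⟨s, hs⟩ := run.init; exact hs.orth_right
    | succ t => exact (run.qr_right t).1
  compl_left := run.compl_left t
  compl_right := run.compl_right t

/-- The QR factors carry the column and row spaces of the new iterate, whatever the pseudoinverse
is. No invertibility is claimed here; that comes from closeness to `Xbar`. -/
lemma exists_factor (t : ℕ) : ∃ M : Matrix (Fin r) (Fin r) ℝ, run.X t = run.U t * M * (run.V t)ᵀ := by
  cases t with
  | zero => obtain ⟨s, hs⟩ := run.init; exact ⟨_, hs.eq⟩
  | succ t =>
    obtain ⟨P, -, hP⟩ := run.update t
    obtain ⟨-, R, -, hR⟩ := run.qr_left t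
    obtain ⟨-, R', -, hR'⟩ := run.qr_right t
    refine ⟨R * P * R'ᵀ, ?_⟩
    rw [hP, hR, hR', Matrix.transpose_mul]
    simp only [Matrix.mul_assoc]

lemma X_succ_eq_assemble {t : ℕ} (hB : IsUnit (run.B t)) :
    run.X (t + 1) = assemble (run.U t) (run.Up t) (run.V t) (run.Vp t) (run.B t) (run.D₂ t)ᵀ
      (run.D₁ t) (run.D₁ t * (run.B t)⁻¹ * (run.D₂ t)ᵀ) := by
  have hB' := (Matrix.isUnit_iff_isUnit_det _).1 hB
  obtain ⟨P, hP, hX⟩ := run.update t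
  rw [hX, hP.eq_inv hB, assemble_eq, Matrix.transpose_add, Matrix.transpose_mul,
    Matrix.transpose_mul, Matrix.transpose_transpose, Matrix.add_mul,
    Matrix.mul_nonsing_inv_cancel_right _ _ hB', Matrix.add_mul, Matrix.mul_add, Matrix.mul_add,
    Matrix.mul_assoc (run.Up t) (run.D₁ t), Matrix.mul_assoc (run.Up t) (_ * _),
    ← Matrix.mul_assoc (_ * _) (run.B t), Matrix.nonsing_inv_mul_cancel_right _ _ hB']
  simp only [Matrix.mul_assoc]
  abel

lemma X_add_eta (t : ℕ) : run.X t + run.eta t =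
    assemble (run.U t) (run.Up t) (run.V t) (run.Vp t) (run.B t) (run.D₂ t)ᵀ (run.D₁ t) 0 :=
  add_sub_cancel _ _

end RISRORun

lemma IsStationaryPoint.exists_isSVD {p₁ p₂ n r : ℕ} {A : Fin n → Matrix (Fin p₁) (Fin p₂) ℝ}
    {y : EuclideanSpace ℝ (Fin n)} {X : Matrix (Fin p₁) (Fin p₂) ℝ}
    (h : IsStationaryPoint A y r X) :
    (LinearMap.adjoint (measurementMap A) (y - measurementMap A X))ᵀ * X = 0 ∧
      X * (LinearMap.adjoint (measurementMap A) (y - measurementMap A X))ᵀ = 0 ∧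
      ∃ U s V, IsSVD X U s V ∧ ∀ i : Fin r, sigma r X ≤ s i := by
  obtain ⟨hr, U, s, V, hsvd, hU, hV⟩ := h
  refine ⟨?_, ?_, U, s, V, hsvd, hsvd.sigma_le hr⟩
  · rw [← neg_sub, map_neg, Matrix.transpose_neg, Matrix.neg_mul, neg_eq_zero]
    conv_lhs => rw [hsvd.eq, ← Matrix.mul_assoc, ← Matrix.mul_assoc, ← hsvd.eq]
    rw [hU, Matrix.zero_mul, Matrix.zero_mul]
  · rw [← neg_sub, map_neg, Matrix.transpose_neg, Matrix.mul_neg, neg_eq_zero]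
    conv_lhs => rw [hsvd.eq, Matrix.mul_assoc, ← Matrix.transpose_mul, ← hsvd.eq]
    rw [hV, Matrix.transpose_zero, Matrix.mul_zero]

/-- All iterates are at least as close to `Xbar` as the initialization, and all middle blocks
`Bᵗ⁺¹` are invertible. -/
lemma RISRORun.error_le_and_isUnit {p₁ p₂ n r : ℕ} (hr : 1 ≤ r)
    {A : Fin n → Matrix (Fin p₁) (Fin p₂) ℝ} {y : EuclideanSpace ℝ (Fin n)}
    {Xbar : Matrix (Fin p₁) (Fin p₂) ℝ} (hXbar : IsStationaryPoint A y r Xbar)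
    (hRIP : HasRIP A (2 * r))
    (run : RISRORun A y r)
    (hinit₁ : ‖run.X 0 - Xbar‖ ≤ 1 / 4 * sigma r Xbar)
    (hinit₂ : 4 * √5 * ripConst A (3 * r) * ‖run.X 0 - Xbar‖ ≤
      (1 - ripConst A (2 * r)) * sigma r Xbar)
    (hres : ‖LinearMap.adjoint (measurementMap A) (y - measurementMap A Xbar)‖ ≤
      (1 - ripConst A (2 * r)) / (4 * √5) * sigma r Xbar)
    (t : ℕ) :
    ‖run.X t - Xbar‖ ≤ ‖run.X 0 - Xbar‖ ∧ IsUnit (run.B t) := by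
  have hσ := sigma_pos hr hXbar.1
  obtain ⟨hG₁, hG₂, Ub, sb, Vb, hsvd, hs⟩ := hXbar.exists_isSVD
  have hX0 : Xbar ≠ 0 := by
    rintro rfl
    have := hXbar.1
    rw [Matrix.rank_zero] at this
    omega
  have hR3 : 0 ≤ ripConst A (3 * r) :=
    ripConst_nonneg A (Z := Xbar) (by rw [hXbar.1]; omega) hX0
  have hstep : ∀ t, ‖run.X t - Xbar‖ ≤ ‖run.X 0 - Xbar‖ →
      ‖run.X (t + 1) - Xbar‖ ≤ ‖run.X 0 - Xbar‖ ∧ IsUnit (run.B t) := by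
    intro t ht
    obtain ⟨M, hM⟩ := run.exists_factor t
    have hF := run.isFrame t
    have hstep := hF.step hM hXbar.1 hsvd hσ hs ht hinit₁ (B := run.B t) (C := (run.D₂ t)ᵀ)
      (D := run.D₁ t) ?_
    · rw [run.X_succ_eq_assemble hstep.1]
      exact ⟨hstep.2, hstep.1⟩
    · refine hF.norm_tangential_error_le hM hXbar.1 hsvd hσ hs hG₁ hG₂ hRIP.2 hR3 ht hinit₁ hinit₂
        hres (hF.blocks_assemble _ _ _ _).2.2.2 ?_
      -- The tangential projection of `Xbar` plus the error `E` is the least squares solution, so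
      -- the normal equations apply to it.
      have h1 : Xbar - run.Up t * ((run.Up t)ᵀ * Xbar * run.Vp t) * (run.Vp t)ᵀ +
          assemble (run.U t) (run.Up t) (run.V t) (run.Vp t)
            (run.B t - (run.U t)ᵀ * Xbar * run.V t) ((run.D₂ t)ᵀ - (run.U t)ᵀ * Xbar * run.Vp t)
            (run.D₁ t - (run.Up t)ᵀ * Xbar * run.V t) 0 =
          assemble (run.U t) (run.Up t) (run.V t) (run.Vp t) (run.B t) (run.D₂ t)ᵀ
            (run.D₁ t) 0 := by
        have h2 := hF.assemble_self Xbar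
        rw [assemble_eq] at h2
        nth_rw 1 [← h2]
        simp only [assemble_eq, Matrix.mul_sub, Matrix.sub_mul, Matrix.mul_zero, Matrix.zero_mul]
        abel
      rw [h1]
      exact hF.normal_equations (run.least_squares t) (hF.blocks_assemble _ _ _ _).2.2.2
  have hle : ∀ t, ‖run.X t - Xbar‖ ≤ ‖run.X 0 - Xbar‖ := by
    intro t
    induction t with
    | zero => exact le_rfl
    | succ t ih => exact (hstep t ih).1
  exact ⟨hle t, (hstep t (hle t)).2⟩

/-- `hinit₂` is cleared of denominators, so that for `R_{3r} = 0` it imposes nothing. -/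
theorem mainTheorem6 {p₁ p₂ n r : ℕ} (hr : 1 ≤ r)
    (A : Fin n → Matrix (Fin p₁) (Fin p₂) ℝ) (y : EuclideanSpace ℝ (Fin n))
    (Xbar : Matrix (Fin p₁) (Fin p₂) ℝ) (hXbar : IsStationaryPoint A y r Xbar)
    (hRIP : HasRIP A (2 * r))
    (run : RISRORun A y r)
    (hinit₁ : ‖run.X 0 - Xbar‖ ≤ 1 / 4 * sigma r Xbar)
    (hinit₂ : 4 * √5 * ripConst A (3 * r) * ‖run.X 0 - Xbar‖ ≤
      (1 - ripConst A (2 * r)) * sigma r Xbar)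
    (hres : ‖LinearMap.adjoint (measurementMap A) (y - measurementMap A Xbar)‖ ≤
      (1 - ripConst A (2 * r)) / (4 * √5) * sigma r Xbar)
    (t : ℕ) :
    -- `Xᵗ` lies on the manifold and `ηᵗ` is a tangent vector there
    (run.X t).rank = r ∧ run.eta t ∈ tangentSpace r (run.X t) ∧
    -- the Riemannian Gauss–Newton equation
    (tangentSpace r (run.X t)).starProjection
        (LinearMap.adjoint (measurementMap A) (measurementMap A (run.eta t))) =
      -riemannianGrad r (objective A y) (run.X t) ∧
    -- the next iterate is the orthographic retraction of `ηᵗ`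
    IsUnit (run.B t) ∧
    run.X (t + 1) = orthographicRetraction (run.U t) (run.Up t) (run.V t) (run.Vp t)
      (run.X t) (run.eta t) ∧
    run.X (t + 1) - (run.X t + run.eta t) ∈ (tangentSpace r (run.X t))ᗮ ∧
    IsRetractionAt r (run.X t)
      (orthographicRetraction (run.U t) (run.Up t) (run.V t) (run.Vp t) (run.X t)) := by
  have hσ := sigma_pos hr hXbar.1
  obtain ⟨-, -, Ub, sb, Vb, hsvd, hs⟩ := hXbar.exists_isSVD
  obtain ⟨he, hB⟩ := run.error_le_and_isUnit hr hXbar hRIP hinit₁ hinit₂ hres t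
  obtain ⟨M, hM⟩ := run.exists_factor t
  have hF := run.isFrame t
  have hMu : IsUnit M := (hsvd.isBoundedBelow_of_norm_sub_le hσ.le hs hF.orth_left hF.orth_right hM
    (he.trans hinit₁) (by linarith)).isUnit (by linarith)
  have hT : ∀ {Z}, Z ∈ tangentSpace r (run.X t) ↔ (run.Up t)ᵀ * Z * run.Vp t = 0 :=
    hF.mem_tangentSpace_iff hM hMu
  obtain ⟨b1, b2, b3, b4⟩ := hF.blocks_assemble (run.B t) (run.D₂ t)ᵀ (run.D₁ t) 0
  rw [← run.X_add_eta t] at b1 b2 b3 b4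
  refine ⟨hF.rank_eq hM hMu, ?_, ?_, hB, ?_, ?_, hF.isRetractionAt hM hMu⟩
  -- `U_⊥ᵀ Xᵗ = 0`, so `ηᵗ` has the same corner as `Xᵗ + ηᵗ`, namely zero.
  · rwa [hT, ← zero_add (_ * run.eta t), ← hF.left_block_zero hM, ← Matrix.mul_add]
  · refine starProjection_eq_neg_riemannianGrad fun Z hZ => ?_
    rw [run.X_add_eta t]
    exact hF.normal_equations (run.least_squares t) (hT.1 hZ)
  · rw [run.X_succ_eq_assemble hB, orthographicRetraction, b1, b2, b3]
  · rw [Submodule.mem_orthogonal']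
    intro Z hZ
    -- Only the corner is added, and tangent vectors have no corner.
    have h1 : run.X (t + 1) - (run.X t + run.eta t) =
        run.Up t * (run.D₁ t * (run.B t)⁻¹ * (run.D₂ t)ᵀ) * (run.Vp t)ᵀ := by
      rw [run.X_succ_eq_assemble hB, run.X_add_eta t, assemble_eq, assemble_eq, Matrix.mul_zero,
        Matrix.zero_mul, add_zero, add_sub_cancel_left]
    rw [h1, frobenius_inner_mul_right, frobenius_inner_mul_left, Matrix.transpose_transpose,
      ← Matrix.mul_assoc, hT.1 hZ, inner_zero_right]
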